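/- Let $\Omega\subset\mathbb R^{n}$ be a bounded open set with Lipschitz boundary, let $1\le q<\infty$ and $0<\gamma\le\Gamma<\infty$, and let $F\colon\mathbb R^{N\times n}\to\mathbb R$ be continuous and convex with $$\gamma|z|\le F(z)\le\Gamma(1+|z|^{q})\qquad\text{for all } z\in\mathbb R^{N\times n},$$ where $|z|$ is the Hilbert–Schmidt norm. Let $u_{0}\in W^{1,q}(\Omega;\mathbb R^{N})$, and let $W^{1,q}_{0}(\Omega;\mathbb R^{N})$ be the closure of $C_c^\infty(\Omega;\mathbb R^{N})$ in $W^{1,q}(\Omega;\mathbb R^{N})$. For $u\in u_{0}+W^{1,q}_{0}(\Omega;\mathbb R^{N})$ put $$\mathscr F[u;\Omega]:=\int_{\Omega}F(\nabla u)\,dx ,$$ and for $u\in BV(\Omega;\mathbb R^{N})$ define the Lebesgue–Serrin–Marcellini extension $$\overline{\mathscr F}^{*}_{u_{0}}[u;\Omega]:=\inf\Big\{\liminf_{j\to\infty}\int_{\Omega}F(\nabla u_{j})\,dx:\ (u_{j})\subset u_{0}+W^{1,q}_{0}(\Omega;\mathbb R^{N}),\ u_{j}\stackrel{*}{\rightharpoonup}u\text{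 in }BV(\Omega;\mathbb R^{N})\Big\},$$ where $u_{j}\stackrel{*}{\rightharpoonup}u$ in $BV(\Omega;\mathbb R^{N})$ means that $u_{j}\to u$ in $L^{1}(\Omega;\mathbb R^{N})$ and $\int_\Omega\langle\varphi,dDu_{j}\rangle\to\int_\Omega\langle\varphi,dDu\rangle$ for all $\varphi\in C_{0}(\Omega;\mathbb R^{N\times n})$, the continuous maps vanishing at the boundary. Then $$\mathscr F[u;\Omega]=\overline{\mathscr F}^{*}_{u_{0}}[u;\Omega]\qquad\text{for all }u\in u_{0}+W^{1,q}_{0}(\Omega;\mathbb R^{N}),$$ and the functional $\overline{\mathscr F}^{*}_{u_{0}}[\,\cdot\,;\Omega]$ attains its minimum over $BV(\Omega;\mathbb R^{N})$, with $$\inf_{u_{0}+W^{1,q}_{0}(\Omega;\mathbb R^{N})}\mathscr F[\,\cdot\,;\Omega]=\min_{BV(\Omega;\mathbb R^{N})}\overline{\mathscr F}^{*}_{u_{0}}[\,\cdot\,;\Omega]\in(-\infty,\infty).$$ -/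

import Mathlib

open MeasureTheory Filter Topology TopologicalSpace
open scoped NNReal ENNReal ContDiff Distributions ZeroAtInfty

namespace LSM

/-- `ℝⁿ` with the Euclidean norm. -/
abbrev E (n : ℕ) : Type := EuclideanSpace ℝ (Fin n)

/-- `ℝ^{N×n}` with the Hilbert–Schmidt inner product and norm; `z (i, k)` is the entry in row `i`
and column `k`. -/
abbrev Mat (N n : ℕ) : Type := EuclideanSpace ℝ (Fin N × Fin n)

/-- Every boundary point has a neighbourhood in which, for some unit vector `e`, the set is the
strict epigraph in direction `e` of a Lipschitz function of the component orthogonal to `e`. -/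
def HasLipschitzBoundary {n : ℕ} (Ω : Opens (E n)) : Prop :=
  ∀ x ∈ frontier (Ω : Set (E n)), ∃ (e : E n) (r : ℝ) (K : ℝ≥0) (ψ : E n → ℝ),
    ‖e‖ = 1 ∧ 0 < r ∧ LipschitzWith K ψ ∧ (∀ (y : E n) (t : ℝ), ψ (y + t • e) = ψ y) ∧
      ∀ y ∈ Metric.ball x r, y ∈ Ω ↔ ψ y < inner ℝ y e

/-- The row-wise divergence `(div φ)_i = ∑ₖ ∂ₖ φ_{ik}`. -/
noncomputable def rowDiv {n N : ℕ} (φ : E n → Mat N n) (x : E n) : E N :=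
  WithLp.toLp 2 fun i => ∑ k, fderiv ℝ φ x (EuclideanSpace.single k 1) (i, k)

/-- The classical gradient `(∇φ)_{ik} = ∂ₖ φ_i`. -/
noncomputable def grad {n N : ℕ} (φ : E n → E N) (x : E n) : Mat N n :=
  WithLp.toLp 2 fun p => fderiv ℝ φ x (EuclideanSpace.single p.2 1) p.1

/-! ### Sobolev functions -/

/-- `G` is the weak gradient of `u` on `Ω`. -/
def HasWeakGrad {n N : ℕ} (Ω : Opens (E n)) (u : E n → E N) (G : E n → Mat N n) : Prop :=
  LocallyIntegrableOn u Ω ∧ LocallyIntegrableOn G Ω ∧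
    ∀ φ : 𝓓(Ω, Mat N n),
      ∫ x in (Ω : Set (E n)), inner ℝ (u x) (rowDiv φ x) =
        -∫ x in (Ω : Set (E n)), inner ℝ (G x) (φ x)

open Classical in
/-- The weak gradient `∇u` on `Ω` (unique up to null sets; `0` if there is none). -/
noncomputable def weakGrad {n N : ℕ} (Ω : Opens (E n)) (u : E n → E N) : E n → Mat N n :=
  if h : ∃ G, HasWeakGrad Ω u G then h.choose else 0

/-- `u ∈ W^{1,q}(Ω; ℝᴺ)`. -/
def MemW1 {n N : ℕ} (q : ℝ) (Ω : Opens (E n)) (u : E n → E N) : Prop :=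
  MemLp u (ENNReal.ofReal q) (volume.restrict Ω) ∧
    ∃ G, HasWeakGrad Ω u G ∧ MemLp G (ENNReal.ofReal q) (volume.restrict Ω)

/-- `u ∈ W₀^{1,q}(Ω; ℝᴺ)`, the closure of `C_c^∞(Ω; ℝᴺ)` in `W^{1,q}(Ω; ℝᴺ)`. -/
def MemW10 {n N : ℕ} (q : ℝ) (Ω : Opens (E n)) (u : E n → E N) : Prop :=
  MemW1 q Ω u ∧ ∃ φ : ℕ → 𝓓(Ω, E N),
    Tendsto (fun j => eLpNorm (fun x => φ j x - u x) (ENNReal.ofReal q) (volume.restrict Ω))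
      atTop (𝓝 0) ∧
    Tendsto (fun j => eLpNorm (fun x => grad (φ j) x - weakGrad Ω u x) (ENNReal.ofReal q)
      (volume.restrict Ω)) atTop (𝓝 0)

/-- The Dirichlet class `u₀ + W₀^{1,q}(Ω; ℝᴺ)`. -/
def dirichletClass {n N : ℕ} (q : ℝ) (Ω : Opens (E n)) (u₀ : E n → E N) : Set (E n → E N) :=
  {v | MemW10 q Ω (fun x => v x - u₀ x)}

/-! ### Functions of bounded variation -/

/-- The total variation `|Du|(Ω)`. -/
noncomputable def totalVariation {n N : ℕ} (Ω : Opens (E n)) (u : E n → E N) : ℝ≥0∞ :=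
  ⨆ (φ : 𝓓(Ω, Mat N n)) (_ : ∀ x, ‖φ x‖ ≤ 1),
    ENNReal.ofReal (∫ x in (Ω : Set (E n)), inner ℝ (u x) (rowDiv φ x))

/-- The space `BV(Ω; ℝᴺ)`. -/
def BV {n : ℕ} (N : ℕ) (Ω : Opens (E n)) : Set (E n → E N) :=
  {u | IntegrableOn u Ω ∧ totalVariation Ω u < ⊤}

/-- `∫_Ω ⟨φ, dμ⟩` for an `ℝ^{N×n}`-valued Borel measure `μ` on `Ω` (which is automatically finite,
and Radon). -/
noncomputable def pairing {n N : ℕ} {Ω : Opens (E n)} (φ : Ω → Mat N n)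
    (μ : VectorMeasure Ω (Mat N n)) : ℝ :=
  ∫ᵛ x, φ x ∂[innerSL ℝ; μ]

/-- The measure `μ` is the distributional derivative `Du` of `u` on `Ω`. -/
def IsDerivMeasure {n N : ℕ} (Ω : Opens (E n)) (u : E n → E N)
    (μ : VectorMeasure Ω (Mat N n)) : Prop :=
  ∀ φ : 𝓓(Ω, Mat N n),
    ∫ x in (Ω : Set (E n)), inner ℝ (u x) (rowDiv φ x) = -pairing (fun x : Ω => φ x) μ

/-- Weak* convergence `u_j ⇀* u` in `BV(Ω; ℝᴺ)`: strong convergence in `L¹` together with weak*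
convergence `Du_j ⇀* Du` of the derivative measures, that is, convergence against all of
`C₀(Ω; ℝ^{N×n})`. -/
def WeakStarConv {n N : ℕ} (Ω : Opens (E n)) (U : ℕ → E n → E N) (u : E n → E N) : Prop :=
  (∀ j, U j ∈ BV N Ω) ∧ u ∈ BV N Ω ∧
  Tendsto (fun j => eLpNorm (fun x => U j x - u x) 1 (volume.restrict Ω)) atTop (𝓝 0) ∧
  ∃ (M : ℕ → VectorMeasure Ω (Mat N n)) (μ : VectorMeasure Ω (Mat N n)),
    (∀ j, IsDerivMeasure Ω (U j) (M j)) ∧ IsDerivMeasure Ω u μ ∧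
    ∀ φ : C₀(Ω, Mat N n), Tendsto (fun j => pairing φ (M j)) atTop (𝓝 (pairing φ μ))

/-! ### The functional and its relaxation -/

/-- `𝓕[u; Ω] = ∫_Ω F(∇u) dx` for a nonnegative integrand `F`. -/
noncomputable def energy {n N : ℕ} (Ω : Opens (E n)) (F : Mat N n → ℝ) (u : E n → E N) : ℝ≥0∞ :=
  ∫⁻ x in (Ω : Set (E n)), ENNReal.ofReal (F (weakGrad Ω u x))

/-- The Lebesgue–Serrin–Marcellini extension of the functional with Dirichlet datum `u₀`. -/
noncomputable def relaxedEnergy {n N : ℕ} (q : ℝ) (Ω : Opens (E n)) (F : Mat N n → ℝ)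
    (u₀ u : E n → E N) : ℝ≥0∞ :=
  sInf {e | ∃ U : ℕ → E n → E N, (∀ j, U j ∈ dirichletClass q Ω u₀) ∧ WeakStarConv Ω U u ∧
    e = liminf (fun j => energy Ω F (U j)) atTop}

end LSM

namespace LSM

open scoped BoundedContinuousFunction Convolution

/-! The equality on the Dirichlet class is lower semicontinuity. The constant sequence is
admissible, so the extension is at most the energy. For the converse, only the `L¹` convergence `u_j
→ u` is needed. Fix a mollifier `ρ` and a point `x` at distance more than its radius from the
complement of `Ω`: there `ρ * ∇u_j` is an integral of `u_j` against a derivative of the kernel, so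
it converges to `ρ * ∇u` (`tendsto_mollify`). Jensen's inequality shows that mollifying does not
increase the integral of the convex `F` (`lintegral_mollify_le`). Fatou's lemma in `j`, and then
again as the mollifier shrinks, gives `lintegral_le_liminf_of_tendsto`.

Existence is the direct method. The bound `γ|z| ≤ F(z)` makes the gradients of a minimizing sequence
bounded in `L¹`, and `exists_subseq_weakStarConv` extracts a weak* convergent subsequence. Its limit
has extension at most the limit of the energies, which is the infimum over the class. No value of
the extension lies below that infimum, because it is an infimum of lower limits of energies from the
class. Minimality therefore needs no lower semicontinuity of the extension.

Both halves of the compactness rest on `exists_subseq_tendsto_integral_mul`, the weak sequential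
compactness of `L¹`-bounded functions carried by a compact set. Applied to the entries of the
gradients, it yields the limit measure. Applied to test functions close to `u_j - u₀`, it makes
their mollifications converge in `L¹`, and the gradient bound makes the mollification error
uniformly small, so the functions themselves converge in `L¹` (Rellich). -/

/-! ### Sequential weak compactness of bounded families of measures -/

/-- Finitely many sequences of finite measures, of bounded mass and carried by one compact set, have
a common weakly convergent subsequence. -/
theorem exists_subseq_tendsto_finiteMeasure {X ι : Type*} [TopologicalSpace X] [MetrizableSpace X]
    [SeparableSpace X] [MeasurableSpace X] [BorelSpace X] [Nonempty X] [Finite ι] {K : Set X}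
    (hK : IsCompact K) {C : ℝ≥0} (μ : ι → ℕ → FiniteMeasure X) (hC : ∀ i j, (μ i j).mass ≤ C)
    (hμ : ∀ i j, μ i j Kᶜ = 0) :
    ∃ s : ℕ → ℕ, StrictMono s ∧ ∃ ν : ι → FiniteMeasure X,
      ∀ i, Tendsto (fun j => μ i (s j)) atTop (𝓝 (ν i)) := by
  classical
  have := Fintype.ofFinite ι
  -- The zero measure normalizes to a Dirac mass at the chosen point of `X`; adding that point to
  -- `K` gives one compact set carrying all the normalized measures.
  set L : Set X := insert (Nonempty.some ‹Nonempty X›) K with hL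
  have hLc : IsCompact L := hK.insert _
  -- Prokhorov's criterion with the constant tightness rate `0`, that is, no mass at all outside
  -- `L`. Directions and masses are then extracted jointly from a product of compact sets.
  have hS : IsCompact {P : ProbabilityMeasure X | ∀ n : ℕ, P Lᶜ ≤ (fun _ => 0 : ℕ → ℝ≥0) n} :=
    isCompact_setOfPred_probabilityMeasure_mass_eq_compl_isCompact_le (K := fun _ => L)
      tendsto_const_nhds (fun _ => hLc) (Or.inr monotone_const)
  have hT := isCompact_univ_pi (X := fun _ : ι => ProbabilityMeasure X × ℝ≥0)
    (s := fun _ => {P : ProbabilityMeasure X | ∀ n : ℕ, P Lᶜ ≤ (fun _ => 0 : ℕ → ℝ≥0) n} ×ˢ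
      Set.Icc 0 C) (fun _ => hS.prod isCompact_Icc)
  have hnorm : ∀ i j, (μ i j).normalize Lᶜ = 0 := by
    intro i j
    have h1 : μ i j Lᶜ = 0 := le_antisymm
      ((FiniteMeasure.apply_mono _ (Set.compl_subset_compl.2 (Set.subset_insert _ _))).trans
        (hμ i j).le) zero_le
    by_cases h0 : μ i j = 0
    · have : (μ i j).mass = 0 := by simp [h0]
      have h2 : ((μ i j).normalize : Measure X) Lᶜ = 0 := by
        have h3 : ((μ i j).normalize : Measure X) = Measure.dirac (Nonempty.some ‹Nonempty X›) :=
          congrArg ProbabilityMeasure.toMeasure (dif_pos this)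
        rw [h3, Measure.dirac_apply' _ hLc.measurableSet.compl]
        simp [hL]
      rw [← ENNReal.coe_eq_zero, ProbabilityMeasure.ennreal_coeFn_eq_coeFn_toMeasure, h2]
    · rw [FiniteMeasure.normalize_eq_of_nonzero _ h0, h1, mul_zero]
  obtain ⟨x, -, s, hs, hx⟩ := hT.isSeqCompact
    (x := fun j i => ((μ i j).normalize, (μ i j).mass))
    (fun j i _ => ⟨fun _ => (hnorm i j).le, zero_le, hC i j⟩)
  refine ⟨s, hs, fun i => (x i).2 • (x i).1.toFiniteMeasure, fun i => ?_⟩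
  have hi := (tendsto_pi_nhds.1 hx i)
  have h1 : Tendsto (fun j => (μ i (s j)).normalize) atTop (𝓝 (x i).1) :=
    (continuous_fst.tendsto _).comp hi
  have h2 : Tendsto (fun j => (μ i (s j)).mass) atTop (𝓝 (x i).2) :=
    (continuous_snd.tendsto _).comp hi
  have h3 := h2.smul ((ProbabilityMeasure.toFiniteMeasure_continuous.tendsto _).comp h1)
  refine h3.congr fun j => ?_
  exact ((μ i (s j)).self_eq_mass_smul_normalize).symm

/-- Finitely many `L¹`-bounded sequences of functions, vanishing outside one compact set, have a
common subsequence converging weakly to differences of finite measures. -/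
theorem exists_subseq_tendsto_integral_mul {X ι : Type*} [TopologicalSpace X] [MetrizableSpace X]
    [SeparableSpace X] [MeasurableSpace X] [BorelSpace X] [Nonempty X] [Finite ι] {m : Measure X}
    {K : Set X} (hK : IsCompact K) {C : ℝ} (f : ι → ℕ → X → ℝ) (hf : ∀ i j, Integrable (f i j) m)
    (hfK : ∀ i j, ∀ x ∉ K, f i j x = 0) (hC : ∀ i j, ∫ x, |f i j x| ∂m ≤ C) :
    ∃ s : ℕ → ℕ, StrictMono s ∧ ∃ ν κ : ι → FiniteMeasure X, ∀ i, ∀ ψ : X →ᵇ ℝ,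
      Tendsto (fun j => ∫ x, ψ x * f i (s j) x ∂m) atTop
        (𝓝 (∫ x, ψ x ∂(ν i : Measure X) - ∫ x, ψ x ∂(κ i : Measure X))) := by
  classical
  -- `ENNReal.ofReal` truncates at zero, so this density is the positive part of `g`. It is used for
  -- `f` and for `-f`, and indexing by `ι ⊕ ι` gives both parts one common subsequence.
  have key : ∀ g : X → ℝ, Integrable g m → (∀ x ∉ K, g x = 0) → ∫ x, |g x| ∂m ≤ C →
      ∃ μ : FiniteMeasure X, (μ : Measure X) = m.withDensity (fun x => ENNReal.ofReal (g x)) ∧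
        μ.mass ≤ C.toNNReal ∧ μ Kᶜ = 0 := by
    intro g hg hgK hgC
    have hle : ∫⁻ x, ENNReal.ofReal (g x) ∂m ≤ ENNReal.ofReal C := by
      calc ∫⁻ x, ENNReal.ofReal (g x) ∂m ≤ ∫⁻ x, ENNReal.ofReal |g x| ∂m :=
            lintegral_mono fun x => ENNReal.ofReal_le_ofReal (le_abs_self _)
        _ = ENNReal.ofReal (∫ x, |g x| ∂m) :=
            (ofReal_integral_eq_lintegral_ofReal hg.abs (ae_of_all _ fun x => abs_nonneg _)).symm
        _ ≤ _ := ENNReal.ofReal_le_ofReal hgC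
    have hfin : IsFiniteMeasure (m.withDensity (fun x => ENNReal.ofReal (g x))) :=
      isFiniteMeasure_withDensity (hle.trans_lt ENNReal.ofReal_lt_top).ne
    obtain ⟨M, hM⟩ : ∃ M : FiniteMeasure X, (M : Measure X) =
      m.withDensity (fun x => ENNReal.ofReal (g x)) := ⟨⟨_, hfin⟩, rfl⟩
    refine ⟨M, hM, ?_, ?_⟩
    · rw [← ENNReal.coe_le_coe, FiniteMeasure.ennreal_mass, hM]
      simpa [withDensity_apply] using! hle
    · rw [← ENNReal.coe_eq_zero, FiniteMeasure.ennreal_coeFn_eq_coeFn_toMeasure, hM]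
      rw [withDensity_apply _ hK.measurableSet.compl]
      rw [setLIntegral_congr_fun (g := fun _ => 0) hK.measurableSet.compl]
      · simp
      · intro x hx
        simp [hgK x hx]
  choose p hp hpC hpK using fun i j => key (f i j) (hf i j) (hfK i j) (hC i j)
  choose q hq hqC hqK using fun i j => key (fun x => -f i j x) (hf i j).neg
    (fun x hx => by simp [hfK i j x hx]) (by simpa using hC i j)
  obtain ⟨s, hs, ν, hν⟩ := exists_subseq_tendsto_finiteMeasure hK (ι := ι ⊕ ι) (C := C.toNNReal)
    (Sum.elim p q) (by rintro (i | i) j <;> simp [hpC, hqC])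
    (by rintro (i | i) j <;> simp [hpK, hqK])
  refine ⟨s, hs, fun i => ν (Sum.inl i), fun i => ν (Sum.inr i), fun i ψ => ?_⟩
  have h1 := (FiniteMeasure.tendsto_iff_forall_integral_tendsto.1 (hν (Sum.inl i))) ψ
  have h2 := (FiniteMeasure.tendsto_iff_forall_integral_tendsto.1 (hν (Sum.inr i))) ψ
  refine (h1.sub h2).congr fun j => ?_
  have hψ : ∀ g : X → ℝ, Integrable g m → Integrable (fun x => ψ x * g x) m := fun g hg =>
    hg.bdd_mul ψ.continuous.aestronglyMeasurable (ae_of_all _ fun x => ψ.norm_coe_le_norm x)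
  have hint : ∀ g : X → ℝ, Integrable g m →
      ∫ x, ψ x ∂(m.withDensity (fun x => ENNReal.ofReal (g x))) =
        ∫ x, ψ x * max (g x) 0 ∂m := by
    intro g hg
    rw [integral_withDensity_eq_integral_toReal_smul₀ hg.aemeasurable.ennreal_ofReal
      (ae_of_all _ fun x => ENNReal.ofReal_lt_top)]
    refine integral_congr_ae (ae_of_all _ fun x => ?_)
    simp only [ENNReal.toReal_ofReal', smul_eq_mul]
    ring
  simp only [Sum.elim_inl, Sum.elim_inr, hp, hq]
  rw [hint _ (hf i _), hint (fun x => -f i (s j) x) (hf i _).neg, ← integral_sub]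
  · refine integral_congr_ae (ae_of_all _ fun x => ?_)
    simp only
    rw [← mul_sub]
    congr 1
    rcases le_total 0 (f i (s j) x) with h | h
    · rw [max_eq_left h, max_eq_right (by linarith)]; ring
    · rw [max_eq_right h, max_eq_left (by linarith)]; ring
  · exact hψ _ (hf i _).pos_part
  · exact hψ _ (hf i _).neg_part

/-! ### Compactness in `L¹` of functions with bounded gradients -/

section Rellich

variable {V : Type*} [NormedAddCommGroup V] [NormedSpace ℝ V] [FiniteDimensional ℝ V]
  [MeasurableSpace V] [BorelSpace V] {μ : Measure V} [μ.IsAddHaarMeasure]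

/-- The fundamental theorem of calculus along the segment from `x` to `x - t`, then Tonelli and
translation invariance. It yields both the Poincaré inequality and the mollification error. -/
theorem lintegral_enorm_translate_sub_le {f : V → ℝ} (hf : ContDiff ℝ 1 f) (t : V) :
    ∫⁻ x, ‖f (x - t) - f x‖ₑ ∂μ ≤ ‖t‖ₑ * ∫⁻ x, ‖fderiv ℝ f x‖ₑ ∂μ := by
  have hc : Continuous (fderiv ℝ f) := hf.continuous_fderiv one_ne_zero
  have h1 : ∀ x, ‖f (x - t) - f x‖ₑ ≤
      ∫⁻ s in Set.Ioc (0 : ℝ) 1, ‖t‖ₑ * ‖fderiv ℝ f (x - s • t)‖ₑ := by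
    intro x
    have hd : ∀ s : ℝ, HasDerivAt (fun s : ℝ => f (x - s • t))
        (fderiv ℝ f (x - s • t) (-t)) s := by
      intro s
      have h2 : HasDerivAt (fun s : ℝ => x - s • t) (-t) s := by
        simpa using ((hasDerivAt_id s).smul_const t).const_sub x
      exact ((hf.differentiable one_ne_zero _).hasFDerivAt).comp_hasDerivAt s h2
    have h3 := intervalIntegral.integral_eq_sub_of_hasDerivAt (a := 0) (b := 1)
      (fun s _ => hd s) (Continuous.intervalIntegrable (by fun_prop) _ _)
    simp only [one_smul, zero_smul, sub_zero] at h3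
    rw [← h3, intervalIntegral.integral_of_le zero_le_one]
    refine (enorm_integral_le_lintegral_enorm _).trans (lintegral_mono fun s => ?_)
    refine (ContinuousLinearMap.le_opENorm _ _).trans ?_
    rw [enorm_neg, mul_comm]
  calc ∫⁻ x, ‖f (x - t) - f x‖ₑ ∂μ
      ≤ ∫⁻ x, (∫⁻ s in Set.Ioc (0 : ℝ) 1, ‖t‖ₑ * ‖fderiv ℝ f (x - s • t)‖ₑ) ∂μ :=
        lintegral_mono h1
    _ = ∫⁻ s in Set.Ioc (0 : ℝ) 1, ∫⁻ x, ‖t‖ₑ * ‖fderiv ℝ f (x - s • t)‖ₑ ∂μ := by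
        refine lintegral_lintegral_swap (Continuous.aemeasurable ?_)
        unfold Function.uncurry
        refine ENNReal.continuous_const_mul (by simp) |>.comp ?_
        fun_prop
    _ = ∫⁻ s in Set.Ioc (0 : ℝ) 1, ‖t‖ₑ * ∫⁻ x, ‖fderiv ℝ f x‖ₑ ∂μ := by
        refine lintegral_congr fun s => ?_
        rw [lintegral_const_mul _ (by fun_prop),
          lintegral_sub_right_eq_self (fun x => ‖fderiv ℝ f x‖ₑ)]
    _ = ‖t‖ₑ * ∫⁻ x, ‖fderiv ℝ f x‖ₑ ∂μ := by simp

/-- The Poincaré inequality for functions supported in a ball. -/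
theorem lintegral_enorm_le_of_support_subset_closedBall [Nontrivial V] {f : V → ℝ}
    (hf : ContDiff ℝ 1 f) {R : ℝ} (hR : 0 ≤ R) (hfR : ∀ x ∉ Metric.closedBall (0 : V) R, f x = 0) :
    ∫⁻ x, ‖f x‖ₑ ∂μ ≤ ENNReal.ofReal (2 * R + 1) * ∫⁻ x, ‖fderiv ℝ f x‖ₑ ∂μ := by
  -- A translation longer than the diameter moves the ball off itself, so on the ball `f` equals
  -- minus its own increment.
  obtain ⟨t, ht⟩ : ∃ t : V, ‖t‖ = 2 * R + 1 := exists_norm_eq V (by positivity)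
  have : ‖t‖ₑ = ENNReal.ofReal (2 * R + 1) := by rw [← ofReal_norm, ht]
  rw [← this]
  refine le_trans (lintegral_mono fun x => ?_) (lintegral_enorm_translate_sub_le hf t)
  by_cases hx : x ∈ Metric.closedBall (0 : V) R
  · have : x - t ∉ Metric.closedBall (0 : V) R := by
      simp only [mem_closedBall_zero_iff, not_le] at hx ⊢
      have := norm_sub_norm_le t x
      rw [norm_sub_rev] at this
      linarith
    simp [hfR _ this]
  · simp [hfR _ hx]

theorem lintegral_ofReal_normed (ρ : ContDiffBump (0 : V)) :
    ∫⁻ t, ENNReal.ofReal (ρ.normed μ t) ∂μ = 1 := by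
  rw [← ofReal_integral_eq_lintegral_ofReal ρ.integrable_normed
    (ae_of_all _ fun t => ρ.nonneg_normed t), ρ.integral_normed, ENNReal.ofReal_one]

/-- The error is an average, with weights `ρ`, of increments by vectors `t` with `‖t‖ < ρ.rOut`,
each controlled by the translation estimate. -/
theorem lintegral_enorm_normed_convolution_sub_le {f : V → ℝ} (hf : ContDiff ℝ 1 f)
    (ρ : ContDiffBump (0 : V)) :
    ∫⁻ x, ‖(ρ.normed μ ⋆[ContinuousLinearMap.lsmul ℝ ℝ, μ] f) x - f x‖ₑ ∂μ ≤
      ENNReal.ofReal ρ.rOut * ∫⁻ x, ‖fderiv ℝ f x‖ₑ ∂μ := by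
  have hρc : Continuous (ρ.normed μ) := ρ.contDiff_normed.continuous (n := 0)
  have h1 : ∀ x, ‖(ρ.normed μ ⋆[ContinuousLinearMap.lsmul ℝ ℝ, μ] f) x - f x‖ₑ ≤
      ∫⁻ t, ENNReal.ofReal (ρ.normed μ t) * ‖f (x - t) - f x‖ₑ ∂μ := by
    intro x
    have h2 : (ρ.normed μ ⋆[ContinuousLinearMap.lsmul ℝ ℝ, μ] f) x - f x =
        ∫ t, ρ.normed μ t * (f (x - t) - f x) ∂μ := by
      have h3 : ∫ t, ρ.normed μ t * f x ∂μ = f x := by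
        rw [integral_mul_const, ρ.integral_normed, one_mul]
      have h4 : Integrable (fun t => ρ.normed μ t * f (x - t)) μ :=
        Continuous.integrable_of_hasCompactSupport (hρc.mul (hf.continuous.comp (by fun_prop)))
          ρ.hasCompactSupport_normed.mul_right
      have h5 : Integrable (fun t => ρ.normed μ t * f x) μ := ρ.integrable_normed.mul_const _
      simp only [mul_sub]
      rw [integral_sub h4 h5, h3]
      rfl
    rw [h2]
    refine (enorm_integral_le_lintegral_enorm _).trans (lintegral_mono fun t => ?_)
    rw [enorm_mul, Real.enorm_of_nonneg (ρ.nonneg_normed t)]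
  calc ∫⁻ x, ‖(ρ.normed μ ⋆[ContinuousLinearMap.lsmul ℝ ℝ, μ] f) x - f x‖ₑ ∂μ
      ≤ ∫⁻ x, ∫⁻ t, ENNReal.ofReal (ρ.normed μ t) * ‖f (x - t) - f x‖ₑ ∂μ ∂μ := lintegral_mono h1
    _ = ∫⁻ t, ∫⁻ x, ENNReal.ofReal (ρ.normed μ t) * ‖f (x - t) - f x‖ₑ ∂μ ∂μ := by
        refine lintegral_lintegral_swap (Measurable.aemeasurable ?_)
        unfold Function.uncurry
        have := hf.continuous
        refine Measurable.mul (ENNReal.continuous_ofReal.comp (hρc.comp continuous_snd)).measurable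
          (Continuous.measurable ?_)
        fun_prop
    _ ≤ ∫⁻ t, ENNReal.ofReal (ρ.normed μ t) *
          (ENNReal.ofReal ρ.rOut * ∫⁻ x, ‖fderiv ℝ f x‖ₑ ∂μ) ∂μ := by
        refine lintegral_mono fun t => ?_
        dsimp only
        rw [lintegral_const_mul']
        swap
        · exact ENNReal.ofReal_ne_top
        by_cases ht : t ∈ Metric.ball (0 : V) ρ.rOut
        · gcongr
          refine (lintegral_enorm_translate_sub_le hf t).trans ?_
          gcongr
          rw [← ofReal_norm]
          exact ENNReal.ofReal_le_ofReal (mem_ball_zero_iff.1 ht).le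
        · have : ρ.normed μ t = 0 := by
            rw [← Function.notMem_support, ρ.support_normed_eq]
            exact ht
          simp [this]
    _ = _ := by
        rw [lintegral_mul_const _ (by fun_prop), lintegral_ofReal_normed, one_mul]

theorem exists_tendsto_lintegral_enorm_sub_of_cauchy {α : Type*} [MeasurableSpace α]
    {m : Measure α} {f : ℕ → α → ℝ} (hf : ∀ j, Integrable (f j) m)
    (hc : ∀ ε > 0, ∃ J, ∀ j ≥ J, ∀ k ≥ J, ∫⁻ x, ‖f j x - f k x‖ₑ ∂m < ε) :
    ∃ g : α → ℝ, Integrable g m ∧ Tendsto (fun j => ∫⁻ x, ‖f j x - g x‖ₑ ∂m) atTop (𝓝 0) := by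
  have hcs : CauchySeq fun j => (hf j).toL1 := by
    rw [EMetric.cauchySeq_iff]
    intro ε hε
    obtain ⟨J, hJ⟩ := hc ε hε
    refine ⟨J, fun j hj k hk => ?_⟩
    rw [Integrable.edist_toL1_toL1]
    simpa only [edist_eq_enorm_sub] using hJ j hj k hk
  obtain ⟨g, hg⟩ := cauchySeq_tendsto_of_complete hcs
  refine ⟨g, L1.integrable_coeFn g, ?_⟩
  have h1 := tendsto_iff_edist_tendsto_0.1 hg
  refine h1.congr fun j => ?_
  rw [← Integrable.toL1_coeFn g (L1.integrable_coeFn g), Integrable.edist_toL1_toL1]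
  refine lintegral_congr_ae ?_
  filter_upwards [Integrable.coeFn_toL1 (L1.integrable_coeFn g)] with x hx
  rw [edist_eq_enorm_sub, hx]

/-- Rellich's theorem for smooth functions supported in a fixed ball. -/
theorem exists_subseq_tendsto_lintegral_enorm_sub [Nontrivial V] {ι : Type*} [Finite ι] {R C : ℝ}
    (hR : 0 ≤ R) (f : ι → ℕ → V → ℝ) (hf : ∀ i j, ContDiff ℝ 1 (f i j))
    (hfR : ∀ i j, ∀ x ∉ Metric.closedBall (0 : V) R, f i j x = 0)
    (hC : ∀ i j, ∫⁻ x, ‖fderiv ℝ (f i j) x‖ₑ ∂μ ≤ ENNReal.ofReal C) :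
    ∃ s : ℕ → ℕ, StrictMono s ∧ ∃ g : ι → V → ℝ, (∀ i, Integrable (g i) μ) ∧
      ∀ i, Tendsto (fun j => ∫⁻ x, ‖f i (s j) x - g i x‖ₑ ∂μ) atTop (𝓝 0) := by
  have hcomp : ∀ i j, HasCompactSupport (f i j) := fun i j =>
    HasCompactSupport.intro (isCompact_closedBall 0 R) (hfR i j)
  have hint : ∀ i j, Integrable (f i j) μ := fun i j =>
    (hf i j).continuous.integrable_of_hasCompactSupport (hcomp i j)
  set B : ℝ := (2 * R + 1) * max C 0 with hB
  have hB0 : 0 ≤ B := by positivity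
  have hL : ∀ i j, ∫⁻ x, ‖f i j x‖ₑ ∂μ ≤ ENNReal.ofReal B := fun i j => by
    refine (lintegral_enorm_le_of_support_subset_closedBall (hf i j) hR (hfR i j)).trans ?_
    rw [hB, ENNReal.ofReal_mul (by positivity)]
    gcongr
    exact (hC i j).trans (ENNReal.ofReal_le_ofReal (le_max_left _ _))
  have hL' : ∀ i j, ∫ x, |f i j x| ∂μ ≤ B := fun i j => by
    rw [← ENNReal.ofReal_le_ofReal_iff hB0]
    refine le_trans (le_of_eq ?_) (hL i j)
    rw [ofReal_integral_eq_lintegral_ofReal (hint i j).abs (ae_of_all _ fun x => abs_nonneg _)]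
    exact lintegral_congr fun x => by rw [← Real.norm_eq_abs, ofReal_norm]
  obtain ⟨s, hs, ν, κ, hνκ⟩ := exists_subseq_tendsto_integral_mul
    (isCompact_closedBall (0 : V) R) f hint hfR hL'
  -- For a fixed bump, the convolution at `x` pairs `f` with the bounded continuous function `y ↦
  -- ρ(x - y)`, so it converges pointwise. It is bounded by `M * B` and vanishes off a larger ball,
  -- so dominated convergence gives `L¹` convergence.
  have hconv : ∀ i, ∀ ρ : ContDiffBump (0 : V), ∃ h : V → ℝ, Measurable h ∧ Tendsto (fun j =>
      ∫⁻ x, ‖(ρ.normed μ ⋆[ContinuousLinearMap.lsmul ℝ ℝ, μ] f i (s j)) x - h x‖ₑ ∂μ)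
        atTop (𝓝 0) := by
    intro i ρ
    have hρc : Continuous (ρ.normed μ) := ρ.contDiff_normed.continuous (n := 0)
    obtain ⟨M, hM⟩ := hρc.bounded_above_of_compact_support ρ.hasCompactSupport_normed
    have hT : ∀ j x, (ρ.normed μ ⋆[ContinuousLinearMap.lsmul ℝ ℝ, μ] f i (s j)) x =
        ∫ y, ρ.normed μ (x - y) * f i (s j) y ∂μ := fun j x => by
      rw [convolution_eq_swap]; rfl
    let ψ : V → (V →ᵇ ℝ) := fun x => BoundedContinuousFunction.ofNormedAddCommGroup
      (fun y => ρ.normed μ (x - y)) (hρc.comp (by fun_prop)) M (fun y => hM _)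
    have hTc : ∀ j, Continuous (ρ.normed μ ⋆[ContinuousLinearMap.lsmul ℝ ℝ, μ] f i (s j)) :=
      fun j => ρ.hasCompactSupport_normed.continuous_convolution_left _ hρc
        (hint i _).locallyIntegrable
    have hlim : ∀ x, Tendsto
        (fun j => (ρ.normed μ ⋆[ContinuousLinearMap.lsmul ℝ ℝ, μ] f i (s j)) x) atTop
        (𝓝 (∫ y, ψ x y ∂(ν i : Measure V) - ∫ y, ψ x y ∂(κ i : Measure V))) := fun x => by
      simp only [hT]
      exact hνκ i (ψ x)
    refine ⟨fun x => ∫ y, ψ x y ∂(ν i : Measure V) - ∫ y, ψ x y ∂(κ i : Measure V),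
      measurable_of_tendsto_metrizable (fun j => (hTc j).measurable) (tendsto_pi_nhds.2 hlim), ?_⟩
    have hM0 : 0 ≤ M := (norm_nonneg _).trans (hM 0)
    have := tendsto_lintegral_norm_of_dominated_convergence (μ := μ)
      (F := fun j x => (ρ.normed μ ⋆[ContinuousLinearMap.lsmul ℝ ℝ, μ] f i (s j)) x)
      (f := fun x => ∫ y, ψ x y ∂(ν i : Measure V) - ∫ y, ψ x y ∂(κ i : Measure V))
      (bound := (Metric.closedBall (0 : V) (R + ρ.rOut)).indicator fun _ => M * B)
      (fun j => (hTc j).aestronglyMeasurable)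
      (((integrable_indicator_iff measurableSet_closedBall).2
        (integrableOn_const (isCompact_closedBall _ _).measure_lt_top.ne)).2)
      (fun j => ae_of_all _ fun x => ?_) (ae_of_all _ hlim)
    · simpa only [ofReal_norm] using this
    · rw [hT]
      by_cases hx : x ∈ Metric.closedBall (0 : V) (R + ρ.rOut)
      · rw [Set.indicator_of_mem hx]
        calc ‖∫ y, ρ.normed μ (x - y) * f i (s j) y ∂μ‖
            ≤ ∫ y, ‖ρ.normed μ (x - y) * f i (s j) y‖ ∂μ := norm_integral_le_integral_norm _
          _ ≤ ∫ y, M * |f i (s j) y| ∂μ := by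
              refine integral_mono_of_nonneg (ae_of_all _ fun y => norm_nonneg _)
                ((hint i _).abs.const_mul M) (ae_of_all _ fun y => ?_)
              simp only [norm_mul, Real.norm_eq_abs (f i (s j) y)]
              exact mul_le_mul_of_nonneg_right (hM _) (abs_nonneg _)
          _ ≤ M * B := by
              rw [integral_const_mul]
              exact mul_le_mul_of_nonneg_left (hL' i _) hM0
      · rw [Set.indicator_of_notMem hx]
        have : ∀ y, ρ.normed μ (x - y) * f i (s j) y = 0 := by
          intro y
          by_cases hy : y ∈ Metric.closedBall (0 : V) R
          · have : ρ.normed μ (x - y) = 0 := by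
              rw [← Function.notMem_support, ρ.support_normed_eq, mem_ball_zero_iff, not_lt]
              rw [mem_closedBall_zero_iff] at hx hy
              have := norm_sub_norm_le x y
              linarith
            rw [this, zero_mul]
          · rw [hfR _ _ _ hy, mul_zero]
        simp [this]
  have hcauchy : ∀ i, ∃ g : V → ℝ, Integrable g μ ∧
      Tendsto (fun j => ∫⁻ x, ‖f i (s j) x - g x‖ₑ ∂μ) atTop (𝓝 0) := by
    intro i
    refine exists_tendsto_lintegral_enorm_sub_of_cauchy (fun j => hint i _) fun ε hε => ?_
    -- The mollification radius is chosen before the indices: its error is below `ε / 4` uniformly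
    -- in `j`. Two such errors and two distances to the limit `h` make up `ε`.
    obtain ⟨δ, hδ0, hδ⟩ : ∃ δ : ℝ, 0 < δ ∧ ENNReal.ofReal δ * ENNReal.ofReal C < ε / 4 := by
      have h4 : 0 < ε / 4 := ENNReal.div_pos hε.ne' (by simp)
      have ht : Tendsto (fun δ : ℝ => ENNReal.ofReal δ * ENNReal.ofReal C) (𝓝[>] 0) (𝓝 0) := by
        have : Tendsto (fun δ : ℝ => ENNReal.ofReal δ * ENNReal.ofReal C) (𝓝 0)
            (𝓝 (ENNReal.ofReal 0 * ENNReal.ofReal C)) :=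
          ENNReal.Tendsto.mul_const ((ENNReal.continuous_ofReal).tendsto 0)
            (Or.inr ENNReal.ofReal_ne_top)
        simp only [ENNReal.ofReal_zero, zero_mul] at this
        exact this.mono_left nhdsWithin_le_nhds
      obtain ⟨δ, h1, h2⟩ := ((ht.eventually (gt_mem_nhds h4)).and self_mem_nhdsWithin).exists
      exact ⟨δ, h2, h1⟩
    let ρ : ContDiffBump (0 : V) := ⟨δ / 2, δ, by positivity, by linarith⟩
    obtain ⟨h, hhm, hh⟩ := hconv i ρ
    have h4 : 0 < ε / 4 := ENNReal.div_pos hε.ne' (by simp)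
    obtain ⟨J, hJ⟩ := eventually_atTop.1 (hh.eventually (gt_mem_nhds h4))
    refine ⟨J, fun j hj k hk => ?_⟩
    set T : ℕ → V → ℝ := fun j => ρ.normed μ ⋆[ContinuousLinearMap.lsmul ℝ ℝ, μ] f i (s j) with hT
    have hρc : Continuous (ρ.normed μ) := ρ.contDiff_normed.continuous (n := 0)
    have hTc : ∀ j, Continuous (T j) := fun j =>
      ρ.hasCompactSupport_normed.continuous_convolution_left _ hρc (hint i _).locallyIntegrable
    have hfc : ∀ j, Continuous (f i (s j)) := fun j => (hf _ _).continuous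
    have hTf : ∀ j, ∫⁻ x, ‖T j x - f i (s j) x‖ₑ ∂μ < ε / 4 := fun j =>
      ((lintegral_enorm_normed_convolution_sub_le (hf _ _) ρ).trans
        (mul_le_mul_right (hC _ _) _)).trans_lt hδ
    have htri : ∀ x, ‖f i (s j) x - f i (s k) x‖ₑ ≤ (‖T j x - f i (s j) x‖ₑ +
        ‖T k x - f i (s k) x‖ₑ) + (‖T j x - h x‖ₑ + ‖T k x - h x‖ₑ) := by
      intro x
      have : f i (s j) x - f i (s k) x = (-(T j x - f i (s j) x) + (T k x - f i (s k) x)) +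
          ((T j x - h x) + -(T k x - h x)) := by ring
      rw [this]
      refine (enorm_add_le _ _).trans (add_le_add ((enorm_add_le _ _).trans ?_)
        ((enorm_add_le _ _).trans ?_))
      · rw [enorm_neg]
      · rw [enorm_neg]
    have hmeas : ∀ j, Measurable fun x => ‖T j x - f i (s j) x‖ₑ := fun j =>
      ((hTc j).sub (hfc j)).enorm.measurable
    refine (lintegral_mono htri).trans_lt ?_
    have hmeas' : ∀ j, Measurable fun x => ‖T j x - h x‖ₑ := fun j =>
      ((hTc j).measurable.sub hhm).enorm
    have hadd : Measurable fun x => ‖T j x - f i (s j) x‖ₑ + ‖T k x - f i (s k) x‖ₑ :=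
      (hmeas j).add (hmeas k)
    rw [lintegral_add_left hadd, lintegral_add_left (hmeas j), lintegral_add_left (hmeas' j)]
    calc _ < (ε / 4 + ε / 4) + (ε / 4 + ε / 4) :=
          ENNReal.add_lt_add (ENNReal.add_lt_add (hTf j) (hTf k))
            (ENNReal.add_lt_add (hJ j hj) (hJ k hk))
      _ = ε := by
          rw [← two_mul, ← two_mul, ← mul_assoc]
          norm_num
          exact ENNReal.mul_div_cancel (by simp) (by simp)
  choose g hg hg' using hcauchy
  exact ⟨s, hs, g, hg, hg'⟩

end Rellich

/-! ### Integrals against vector measures with a density -/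

section Pairing

variable {α H : Type*} [MeasurableSpace α] [NormedAddCommGroup H] [InnerProductSpace ℝ H]
  {κ : Measure α} {g : α → H}

theorem isFiniteMeasure_variation_withDensityᵥ [CompleteSpace H] (hg : Integrable g κ) :
    IsFiniteMeasure (κ.withDensityᵥ g).variation := by
  rw [Measure.variation_withDensityᵥ hg]
  exact isFiniteMeasure_withDensity hg.2.ne

theorem integrable_variation_withDensityᵥ [CompleteSpace H] (hg : Integrable g κ) {φ : α → H}
    (hφ : StronglyMeasurable φ) {C : ℝ} (hC : ∀ x, ‖φ x‖ ≤ C) :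
    (κ.withDensityᵥ g).Integrable φ := by
  have := isFiniteMeasure_variation_withDensityᵥ hg
  exact Integrable.of_bound hφ.aestronglyMeasurable C (ae_of_all _ hC)

theorem integrable_inner_of_bound (hg : Integrable g κ) {φ : α → H}
    (hφ : AEStronglyMeasurable φ κ) {C : ℝ} (hC : ∀ x, ‖φ x‖ ≤ C) :
    Integrable (fun x => inner ℝ (φ x) (g x)) κ := by
  refine (hg.norm.const_mul C).mono' (hφ.inner hg.aestronglyMeasurable) (ae_of_all _ fun x => ?_)
  exact (norm_inner_le_norm _ _).trans (mul_le_mul_of_nonneg_right (hC x) (norm_nonneg _))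

theorem integral_withDensityᵥ_simpleFunc [CompleteSpace H] (hg : Integrable g κ) (φ : SimpleFunc α H) :
    ∫ᵛ x, φ x ∂[innerSL ℝ; κ.withDensityᵥ g] = ∫ x, inner ℝ (φ x) (g x) ∂κ := by
  have hfin := isFiniteMeasure_variation_withDensityᵥ hg
  induction φ using SimpleFunc.induction with
  | const c hs =>
    rename_i s
    simp only [SimpleFunc.const_zero, SimpleFunc.coe_piecewise, SimpleFunc.coe_const,
      SimpleFunc.coe_zero, Set.piecewise_eq_indicator]
    have h1 : ∫ᵛ x, s.indicator (Function.const α c) x ∂[innerSL ℝ; κ.withDensityᵥ g] =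
        innerSL ℝ c (κ.withDensityᵥ g s) :=
      VectorMeasure.integral_indicator_const c hs
    rw [h1, withDensityᵥ_apply hg hs, innerSL_apply_apply, ← integral_inner hg.integrableOn,
      ← integral_indicator hs]
    refine integral_congr_ae (ae_of_all _ fun x => ?_)
    by_cases hx : x ∈ s <;> simp [hx]
  | add hd hf hf' =>
    rename_i f f'
    obtain ⟨C, hC⟩ := f.exists_forall_norm_le
    obtain ⟨C', hC'⟩ := f'.exists_forall_norm_le
    simp only [SimpleFunc.coe_add, Pi.add_apply, inner_add_left]
    rw [VectorMeasure.integral_fun_add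
        (integrable_variation_withDensityᵥ hg f.stronglyMeasurable hC)
        (integrable_variation_withDensityᵥ hg f'.stronglyMeasurable hC'), hf, hf',
      integral_add (integrable_inner_of_bound hg f.aestronglyMeasurable hC)
        (integrable_inner_of_bound hg f'.aestronglyMeasurable hC')]

/-- The variation of `g κ` is finite, so bounded simple approximations of `φ` pass to the limit on
both sides by dominated convergence. Pairings with gradient measures thus become Bochner integrals.
-/
theorem integral_withDensityᵥ_eq [CompleteSpace H] (hg : Integrable g κ) {φ : α → H}
    (hφ : StronglyMeasurable φ) {C : ℝ} (hC : ∀ x, ‖φ x‖ ≤ C) :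
    ∫ᵛ x, φ x ∂[innerSL ℝ; κ.withDensityᵥ g] = ∫ x, inner ℝ (φ x) (g x) ∂κ := by
  have hfin := isFiniteMeasure_variation_withDensityᵥ hg
  have hb : ∀ k x, ‖hφ.approxBounded (max C 0) k x‖ ≤ max C 0 := fun k x =>
    hφ.norm_approxBounded_le (le_max_right _ _) k x
  have hl : ∀ x, Tendsto (fun k => hφ.approxBounded (max C 0) k x) atTop (𝓝 (φ x)) := fun x =>
    hφ.tendsto_approxBounded_of_norm_le ((hC x).trans (le_max_left _ _))
  have h1 : Tendsto (fun k => ∫ᵛ x, hφ.approxBounded (max C 0) k x ∂[innerSL ℝ; κ.withDensityᵥ g])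
      atTop (𝓝 (∫ᵛ x, φ x ∂[innerSL ℝ; κ.withDensityᵥ g])) :=
    VectorMeasure.tendsto_integral_of_dominated_convergence (fun _ => max C 0)
      (fun k => SimpleFunc.aestronglyMeasurable _) (integrable_const _)
      (fun k => ae_of_all _ (hb k)) (ae_of_all _ hl)
  have h2 : Tendsto (fun k => ∫ x, inner ℝ (hφ.approxBounded (max C 0) k x) (g x) ∂κ)
      atTop (𝓝 (∫ x, inner ℝ (φ x) (g x) ∂κ)) := by
    refine tendsto_integral_of_dominated_convergence (fun x => max C 0 * ‖g x‖)
      (fun k => (SimpleFunc.aestronglyMeasurable _).inner hg.aestronglyMeasurable)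
      (hg.norm.const_mul _) (fun k => ae_of_all _ fun x => ?_)
      (ae_of_all _ fun x => (hl x).inner tendsto_const_nhds)
    exact (norm_inner_le_norm _ _).trans (mul_le_mul_of_nonneg_right (hb k x) (norm_nonneg _))
  refine tendsto_nhds_unique h1 (h2.congr fun k => ?_)
  exact (integral_withDensityᵥ_simpleFunc hg _).symm

end Pairing

/-! ### Weak gradients -/

section WeakGrad

variable {n N : ℕ} {Ω : Opens (E n)}

theorem continuous_rowDiv (φ : 𝓓(Ω, Mat N n)) : Continuous (rowDiv φ) := by
  have h : Continuous (fderiv ℝ φ) := φ.contDiff.continuous_fderiv (by simp)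
  unfold rowDiv
  refine (PiLp.continuous_toLp 2 _).comp (continuous_pi fun i => ?_)
  refine continuous_finsetSum _ fun k _ => ?_
  exact (PiLp.continuous_apply 2 _ (i, k)).comp (h.clm_apply continuous_const)

theorem tsupport_rowDiv_subset (φ : 𝓓(Ω, Mat N n)) : tsupport (rowDiv φ) ⊆ tsupport φ := by
  refine closure_minimal (fun x hx => ?_) (isClosed_tsupport _)
  by_contra h
  refine hx ?_
  have : fderiv ℝ φ x = 0 := by
    by_contra h'
    exact h (support_fderiv_subset ℝ h')
  ext i
  simp [rowDiv, this]

theorem hasCompactSupport_rowDiv (φ : 𝓓(Ω, Mat N n)) : HasCompactSupport (rowDiv φ) :=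
  φ.hasCompactSupport.of_isClosed_subset (isClosed_tsupport _) (tsupport_rowDiv_subset φ)

theorem integrableOn_inner_of_tsupport_subset {H : Type*} [NormedAddCommGroup H]
    [InnerProductSpace ℝ H] {G : E n → H} (hG : LocallyIntegrableOn G Ω) {ψ : E n → H}
    (hψ : Continuous ψ) (hc : HasCompactSupport ψ) (hs : tsupport ψ ⊆ Ω) :
    IntegrableOn (fun x => inner ℝ (G x) (ψ x)) Ω := by
  have h1 : IntegrableOn G (tsupport ψ) := hG.integrableOn_compact_subset hs hc
  obtain ⟨M, hM⟩ := hψ.bounded_above_of_compact_support hc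
  have h2 : IntegrableOn (fun x => inner ℝ (G x) (ψ x)) (tsupport ψ) := by
    refine (h1.norm.const_mul M).mono' (h1.aestronglyMeasurable.inner hψ.aestronglyMeasurable)
      (ae_of_all _ fun x => ?_)
    rw [mul_comm]
    exact (norm_inner_le_norm _ _).trans (mul_le_mul_of_nonneg_left (hM x) (norm_nonneg _))
  have h3 : Function.support (fun x => inner ℝ (G x) (ψ x)) ⊆ tsupport ψ := by
    intro x hx
    refine subset_tsupport _ fun h => hx ?_
    simp [h]
  exact ((integrableOn_iff_integrable_of_support_subset h3).1 h2).integrableOn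

theorem integrableOn_inner_rowDiv {u : E n → E N} (hu : LocallyIntegrableOn u Ω)
    (φ : 𝓓(Ω, Mat N n)) : IntegrableOn (fun x => inner ℝ (u x) (rowDiv φ x)) Ω :=
  integrableOn_inner_of_tsupport_subset hu (continuous_rowDiv φ) (hasCompactSupport_rowDiv φ)
    ((tsupport_rowDiv_subset φ).trans φ.tsupport_subset)

theorem integrableOn_inner_testFunction {G : E n → Mat N n} (hG : LocallyIntegrableOn G Ω)
    (φ : 𝓓(Ω, Mat N n)) : IntegrableOn (fun x => inner ℝ (G x) (φ x)) Ω :=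
  integrableOn_inner_of_tsupport_subset hG φ.continuous φ.hasCompactSupport φ.tsupport_subset

/-- The test function `g • c` for a scalar test function `g` and a constant matrix `c`. -/
def smulTestFunction (g : E n → ℝ) (hg : ContDiff ℝ ∞ g) (hc : HasCompactSupport g)
    (hs : tsupport g ⊆ Ω) (c : Mat N n) : 𝓓(Ω, Mat N n) where
  toFun x := g x • c
  contDiff' := hg.smul contDiff_const
  hasCompactSupport' := hc.smul_right
  tsupport_subset' := (tsupport_smul_subset_left g _).trans hs

/-- The fundamental lemma of the calculus of variations, tested with `g • c` for scalar `g` and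
constant matrices `c`. It makes the chosen `weakGrad` interchangeable with any other weak gradient.
-/
theorem HasWeakGrad.ae_eq {u : E n → E N} {G G' : E n → Mat N n} (h : HasWeakGrad Ω u G)
    (h' : HasWeakGrad Ω u G') : G =ᵐ[volume.restrict Ω] G' := by
  have hGG : LocallyIntegrableOn (fun x => G x - G' x) Ω := h.2.1.sub h'.2.1
  have := Ω.isOpen.ae_eq_zero_of_integral_contDiff_smul_eq_zero hGG ?_
  · rw [EventuallyEq, ae_restrict_iff' Ω.isOpen.measurableSet]
    filter_upwards [this] with x hx hxΩ
    exact sub_eq_zero.1 (hx hxΩ)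
  intro g hg hc hs
  refine ext_inner_left ℝ fun c => ?_
  have hint : Integrable (fun x => g x • (G x - G' x)) := by
    have h3 : Function.support (fun x => g x • (G x - G' x)) ⊆ tsupport g := fun x hx =>
      subset_tsupport _ fun h => hx (by simp [h])
    refine (integrableOn_iff_integrable_of_support_subset h3).1 ?_
    exact (hGG.integrableOn_compact_subset hs hc).continuousOn_smul hg.continuous.continuousOn hc
  rw [inner_zero_right, ← integral_inner hint]
  have h4 : ∫ x, inner ℝ c (g x • (G x - G' x)) =
      ∫ x in (Ω : Set (E n)), inner ℝ c (g x • (G x - G' x)) := by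
    refine (setIntegral_eq_integral_of_forall_compl_eq_zero fun x hx => ?_).symm
    have : g x = 0 := by
      by_contra h0
      exact hx (hs (subset_tsupport _ h0))
    simp [this]
  rw [h4]
  have h5 := h.2.2 (smulTestFunction g hg hc hs c)
  have h6 := h'.2.2 (smulTestFunction g hg hc hs c)
  rw [h5, neg_inj] at h6
  rw [← sub_eq_zero, ← integral_sub (integrableOn_inner_testFunction h.2.1 _)
    (integrableOn_inner_testFunction h'.2.1 _)] at h6
  rw [← h6]
  refine integral_congr_ae (ae_of_all _ fun x => ?_)
  change inner ℝ c (g x • (G x - G' x)) = inner ℝ (G x) (g x • c) - inner ℝ (G' x) (g x • c)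
  rw [← inner_sub_left, inner_smul_right, inner_smul_right, real_inner_comm]

theorem HasWeakGrad.add {u v : E n → E N} {G G' : E n → Mat N n} (h : HasWeakGrad Ω u G)
    (h' : HasWeakGrad Ω v G') : HasWeakGrad Ω (fun x => u x + v x) (fun x => G x + G' x) := by
  refine ⟨h.1.add h'.1, h.2.1.add h'.2.1, fun φ => ?_⟩
  simp only [inner_add_left]
  rw [integral_add (integrableOn_inner_rowDiv h.1 φ) (integrableOn_inner_rowDiv h'.1 φ),
    integral_add (integrableOn_inner_testFunction h.2.1 φ)
      (integrableOn_inner_testFunction h'.2.1 φ), h.2.2, h'.2.2]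
  ring

theorem hasWeakGrad_zero : HasWeakGrad Ω (fun _ => (0 : E N)) (fun _ => (0 : Mat N n)) :=
  ⟨locallyIntegrableOn_zero, locallyIntegrableOn_zero, fun φ => by simp⟩

theorem HasWeakGrad.weakGrad {u : E n → E N} {G : E n → Mat N n} (h : HasWeakGrad Ω u G) :
    HasWeakGrad Ω u (weakGrad Ω u) := by
  have h' : ∃ G, HasWeakGrad Ω u G := ⟨G, h⟩
  rw [LSM.weakGrad, dif_pos h']
  exact h'.choose_spec

theorem HasWeakGrad.weakGrad_ae_eq {u : E n → E N} {G : E n → Mat N n} (h : HasWeakGrad Ω u G) :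
    LSM.weakGrad Ω u =ᵐ[volume.restrict Ω] G :=
  h.weakGrad.ae_eq h

theorem MemW1.hasWeakGrad {q : ℝ} {u : E n → E N} (h : MemW1 q Ω u) :
    HasWeakGrad Ω u (weakGrad Ω u) :=
  let ⟨_, _, hG, _⟩ := h
  hG.weakGrad

theorem MemW1.memLp_weakGrad {q : ℝ} {u : E n → E N} (h : MemW1 q Ω u) :
    MemLp (weakGrad Ω u) (ENNReal.ofReal q) (volume.restrict Ω) :=
  let ⟨_, _, hG, hG'⟩ := h
  hG'.ae_eq hG.weakGrad_ae_eq.symm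

theorem MemW1.add {q : ℝ} {u v : E n → E N} (h : MemW1 q Ω u) (h' : MemW1 q Ω v) :
    MemW1 q Ω (fun x => u x + v x) :=
  ⟨h.1.add h'.1, _, h.hasWeakGrad.add h'.hasWeakGrad, h.memLp_weakGrad.add h'.memLp_weakGrad⟩

theorem weakGrad_add_ae_eq {q : ℝ} {u v : E n → E N} (h : MemW1 q Ω u) (h' : MemW1 q Ω v) :
    weakGrad Ω (fun x => u x + v x) =ᵐ[volume.restrict Ω]
      fun x => weakGrad Ω u x + weakGrad Ω v x :=
  (h.hasWeakGrad.add h'.hasWeakGrad).weakGrad_ae_eq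

theorem memW10_zero (q : ℝ) : MemW10 q Ω (fun _ => (0 : E N)) := by
  refine ⟨⟨MemLp.zero', _, hasWeakGrad_zero, MemLp.zero'⟩, fun _ => 0, ?_, ?_⟩
  · simp
  · have h1 : (fun x => grad (0 : 𝓓(Ω, E N)) x - weakGrad Ω (fun _ => (0 : E N)) x)
        =ᵐ[volume.restrict Ω] fun _ => 0 := by
      filter_upwards [(hasWeakGrad_zero (Ω := Ω) (N := N)).weakGrad_ae_eq] with x hx
      rw [hx]
      ext p
      simp [grad]
    have h2 := eLpNorm_congr_ae (p := ENNReal.ofReal q) h1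
    simp only [eLpNorm_zero'] at h2
    exact tendsto_const_nhds.congr fun _ => h2.symm

theorem self_mem_dirichletClass (q : ℝ) (u₀ : E n → E N) : u₀ ∈ dirichletClass q Ω u₀ := by
  simpa [dirichletClass] using memW10_zero q

theorem memW1_of_mem_dirichletClass {q : ℝ} {u₀ u : E n → E N} (hu₀ : MemW1 q Ω u₀)
    (hu : u ∈ dirichletClass q Ω u₀) : MemW1 q Ω u := by
  have := MemW1.add hu.1 hu₀
  simpa using this

theorem isFiniteMeasure_restrict_of_isBounded (hΩ : Bornology.IsBounded (Ω : Set (E n))) :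
    IsFiniteMeasure (volume.restrict (Ω : Set (E n))) :=
  ⟨by simpa using hΩ.measure_lt_top⟩

theorem MemW1.integrableOn (hΩ : Bornology.IsBounded (Ω : Set (E n))) {q : ℝ}
    (hq : 1 ≤ q) {u : E n → E N} (h : MemW1 q Ω u) :
    IntegrableOn u Ω :=
  have := isFiniteMeasure_restrict_of_isBounded hΩ
  h.1.integrable (by simpa using hq)

theorem MemW1.integrableOn_weakGrad (hΩ : Bornology.IsBounded (Ω : Set (E n))) {q : ℝ}
    (hq : 1 ≤ q) {u : E n → E N} (h : MemW1 q Ω u) :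
    IntegrableOn (weakGrad Ω u) Ω :=
  have := isFiniteMeasure_restrict_of_isBounded hΩ
  h.memLp_weakGrad.integrable (by simpa using hq)

theorem energy_lt_top (hΩ : Bornology.IsBounded (Ω : Set (E n))) {q : ℝ}
    (hq : 1 ≤ q) {u : E n → E N} (h : MemW1 q Ω u) {F : Mat N n → ℝ}
    {Γ : ℝ} (hF : ∀ z, F z ≤ Γ * (1 + ‖z‖ ^ q)) : energy Ω F u < ⊤ := by
  have := isFiniteMeasure_restrict_of_isBounded hΩ
  have hq' : ENNReal.ofReal q ≠ 0 := by simpa using by linarith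
  have h1 := h.memLp_weakGrad.integrable_norm_rpow hq' ENNReal.ofReal_ne_top
  rw [ENNReal.toReal_ofReal (by linarith)] at h1
  have h2 : Integrable (fun x => Γ * (1 + ‖weakGrad Ω u x‖ ^ q)) (volume.restrict Ω) :=
    ((integrable_const 1).add h1).const_mul Γ
  exact (lintegral_mono fun x => ENNReal.ofReal_le_ofReal (hF _)).trans_lt
    (lt_of_le_of_lt (lintegral_ofReal_le_lintegral_enorm _) h2.2)

end WeakGrad

/-! ### Derivative measures -/

section Deriv

variable {n N : ℕ} {Ω : Opens (E n)}

theorem totalVariation_le_ofReal {u : E n → E N} {C : ℝ} (h : ∀ φ : 𝓓(Ω, Mat N n),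
    (∀ x, ‖φ x‖ ≤ 1) → ∫ x in (Ω : Set (E n)), inner ℝ (u x) (rowDiv φ x) ≤ C) :
    totalVariation Ω u ≤ ENNReal.ofReal C :=
  iSup₂_le fun φ hφ => ENNReal.ofReal_le_ofReal (h φ hφ)

theorem HasWeakGrad.integral_inner_rowDiv_le {u : E n → E N} {G : E n → Mat N n}
    (h : HasWeakGrad Ω u G) (hG : IntegrableOn G Ω) (φ : 𝓓(Ω, Mat N n)) (hφ : ∀ x, ‖φ x‖ ≤ 1) :
    ∫ x in (Ω : Set (E n)), inner ℝ (u x) (rowDiv φ x) ≤ ∫ x in (Ω : Set (E n)), ‖G x‖ := by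
  rw [h.2.2, ← integral_neg]
  refine integral_mono (integrableOn_inner_testFunction h.2.1 φ).neg hG.norm fun x => ?_
  refine (neg_le_abs _).trans ((abs_real_inner_le_norm _ _).trans ?_)
  exact mul_le_of_le_one_right (norm_nonneg _) (hφ x)

theorem HasWeakGrad.mem_BV {u : E n → E N} {G : E n → Mat N n}
    (h : HasWeakGrad Ω u G) (hu : IntegrableOn u Ω) (hG : IntegrableOn G Ω) : u ∈ BV N Ω :=
  ⟨hu, (totalVariation_le_ofReal fun φ hφ => h.integral_inner_rowDiv_le hG φ hφ).trans_lt
    ENNReal.ofReal_lt_top⟩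

/-- The vector measure `G dx` on `Ω`. -/
noncomputable def densityMeasure (Ω : Opens (E n)) (G : E n → Mat N n) :
    VectorMeasure Ω (Mat N n) :=
  (volume.comap (Subtype.val : Ω → E n)).withDensityᵥ fun x => G x

theorem pairing_densityMeasure {G : E n → Mat N n} (hG : IntegrableOn G Ω) (Φ : E n →ᵇ Mat N n) :
    pairing (fun x : Ω => Φ x) (densityMeasure Ω G) =
      ∫ x in (Ω : Set (E n)), inner ℝ (Φ x) (G x) := by
  have hG' : Integrable (fun x : Ω => G x) (volume.comap (Subtype.val : Ω → E n)) :=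
    (integrableOn_iff_comap_subtypeVal Ω.isOpen.measurableSet).1 hG
  have hsm : StronglyMeasurable (fun x : Ω => Φ x) :=
    (Φ.continuous.comp continuous_subtype_val).stronglyMeasurable
  unfold pairing densityMeasure
  rw [integral_withDensityᵥ_eq hG' hsm (fun x => Φ.norm_coe_le_norm x)]
  exact integral_subtype_comap Ω.isOpen.measurableSet fun x => inner ℝ (Φ x) (G x)

/-- A test function as a bounded continuous function. -/
noncomputable def testFunctionToBCF (φ : 𝓓(Ω, Mat N n)) : E n →ᵇ Mat N n :=
  BoundedContinuousFunction.ofNormedAddCommGroup φ φ.continuous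
    (φ.continuous.bounded_above_of_compact_support φ.hasCompactSupport).choose
    (φ.continuous.bounded_above_of_compact_support φ.hasCompactSupport).choose_spec

theorem HasWeakGrad.isDerivMeasure {u : E n → E N} {G : E n → Mat N n}
    (h : HasWeakGrad Ω u G) (hG : IntegrableOn G Ω) : IsDerivMeasure Ω u (densityMeasure Ω G) := by
  intro φ
  rw [h.2.2, neg_inj]
  refine Eq.trans ?_ (pairing_densityMeasure hG (testFunctionToBCF φ)).symm
  exact integral_congr_ae (ae_of_all _ fun x => real_inner_comm _ _)

/-- Functions vanishing at the boundary extend by zero to bounded continuous functions. -/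
theorem exists_boundedContinuousFunction_extend {X H : Type*} [TopologicalSpace X] [T2Space X]
    [NormedAddCommGroup H] {Ω : Opens X} (φ : C₀(Ω, H)) :
    ∃ Φ : X →ᵇ H, (∀ x : Ω, Φ x = φ x) ∧ ∀ x ∉ Ω, Φ x = 0 := by
  classical
  let f : X → H := fun x => if h : x ∈ Ω then φ ⟨x, h⟩ else 0
  have hf1 : ∀ x : Ω, f x = φ x := fun x => dif_pos x.2
  have hf0 : ∀ x ∉ Ω, f x = 0 := fun x hx => dif_neg hx
  have hcont : Continuous f := by
    refine continuous_iff_continuousAt.2 fun x => ?_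
    by_cases hx : x ∈ Ω
    · have h1 : ContinuousOn f Ω := by
        rw [continuousOn_iff_continuous_domRestrict]
        exact φ.continuous.congr fun x => (hf1 x).symm
      exact h1.continuousAt (Ω.isOpen.mem_nhds hx)
    · rw [ContinuousAt, hf0 x hx, Metric.tendsto_nhds]
      intro ε hε
      have h2 := (Metric.tendsto_nhds.1 (zero_at_infty φ)) ε hε
      obtain ⟨K, hK, hKs⟩ := mem_cocompact.1 h2
      -- A compact subset of `Ω` is compact, hence closed, in `X`, so a point outside `Ω` has a
      -- neighbourhood avoiding it; on that neighbourhood the extension is smaller than `ε`.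
      have hK' : IsCompact (Subtype.val '' K : Set X) := hK.image continuous_subtype_val
      have hxK : x ∈ (Subtype.val '' K : Set X)ᶜ := by
        rintro ⟨y, -, rfl⟩
        exact hx y.2
      filter_upwards [hK'.isClosed.isOpen_compl.mem_nhds hxK] with y hy
      by_cases hyΩ : y ∈ Ω
      · have : (⟨y, hyΩ⟩ : Ω) ∈ Kᶜ := fun h => hy ⟨_, h, rfl⟩
        have := hKs this
        rw [hf1 ⟨y, hyΩ⟩]
        exact this
      · simpa [hf0 y hyΩ] using hε
  refine ⟨BoundedContinuousFunction.ofNormedAddCommGroup f hcont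
    ‖ZeroAtInftyContinuousMap.toBCF φ‖ fun x => ?_, hf1, hf0⟩
  by_cases hx : x ∈ Ω
  · rw [hf1 ⟨x, hx⟩]
    exact (ZeroAtInftyContinuousMap.toBCF φ).norm_coe_le_norm ⟨x, hx⟩
  · rw [hf0 x hx, norm_zero]
    exact norm_nonneg _

/-- The matrix-valued measure on `Ω` with entries `ν p - κ p`. -/
noncomputable def entryMeasure (Ω : Opens (E n)) (ν κ : Fin N × Fin n → FiniteMeasure (E n)) :
    VectorMeasure Ω (Mat N n) :=
  ∑ p, (((ν p : Measure (E n)).comap (Subtype.val : Ω → E n)).withDensityᵥ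
      (fun _ => EuclideanSpace.single p 1) -
    ((κ p : Measure (E n)).comap (Subtype.val : Ω → E n)).withDensityᵥ
      (fun _ => EuclideanSpace.single p 1))

/-- The measures `ν p` and `κ p` may charge the boundary of `Ω`, and pulling them back to `Ω`
discards that mass. The pairing does not see the loss because `Φ` vanishes off `Ω`. -/
theorem pairing_entryMeasure (ν κ : Fin N × Fin n → FiniteMeasure (E n)) (Φ : E n →ᵇ Mat N n)
    (hΦ : ∀ x ∉ Ω, Φ x = 0) :
    pairing (fun x : Ω => Φ x) (entryMeasure Ω ν κ) =
      ∑ p, (∫ x, Φ x p ∂(ν p : Measure (E n)) - ∫ x, Φ x p ∂(κ p : Measure (E n))) := by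
  have hfin : ∀ ν : FiniteMeasure (E n),
      IsFiniteMeasure ((ν : Measure (E n)).comap (Subtype.val : Ω → E n)) := fun ν => by
    have h := (MeasurableEmbedding.subtype_coe Ω.isOpen.measurableSet).comap_apply
      (ν : Measure (E n)) Set.univ
    exact ⟨h.trans_lt (measure_lt_top _ _)⟩
  have hsm : StronglyMeasurable (fun x : Ω => Φ x) :=
    (Φ.continuous.comp continuous_subtype_val).stronglyMeasurable
  have hI : ∀ (ν : FiniteMeasure (E n)) (p : Fin N × Fin n),
      (((ν : Measure (E n)).comap (Subtype.val : Ω → E n)).withDensityᵥ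
        (fun _ => (EuclideanSpace.single p 1 : Mat N n))).Integrable (fun x : Ω => Φ x) :=
    fun ν p => by
      have := hfin ν
      exact integrable_variation_withDensityᵥ (integrable_const _) hsm
        (fun x => Φ.norm_coe_le_norm x)
  have hE : ∀ (ν : FiniteMeasure (E n)) (p : Fin N × Fin n),
      ∫ᵛ x, Φ x ∂[innerSL ℝ; ((ν : Measure (E n)).comap (Subtype.val : Ω → E n)).withDensityᵥ
        (fun _ => (EuclideanSpace.single p 1 : Mat N n))] = ∫ x, Φ x p ∂(ν : Measure (E n)) :=
    fun ν p => by
      have := hfin ν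
      rw [integral_withDensityᵥ_eq (integrable_const _) hsm (fun x => Φ.norm_coe_le_norm x)]
      have h1 := integral_subtype_comap (μ := (ν : Measure (E n))) Ω.isOpen.measurableSet
        fun x => inner ℝ (Φ x) (EuclideanSpace.single p 1 : Mat N n)
      refine h1.trans ?_
      rw [setIntegral_eq_integral_of_forall_compl_eq_zero fun x hx => by simp [hΦ x hx]]
      refine integral_congr_ae (ae_of_all _ fun x => ?_)
      simp [EuclideanSpace.inner_single_right]
  unfold pairing entryMeasure
  rw [VectorMeasure.integral_finsetSum_vectorMeasure fun p _ => (hI _ p).sub_vectorMeasure (hI _ p)]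
  refine Finset.sum_congr rfl fun p _ => ?_
  rw [VectorMeasure.integral_sub_vectorMeasure (hI _ p) (hI _ p), hE, hE]

theorem weakStarConv_const {u : E n → E N} {G : E n → Mat N n} (h : HasWeakGrad Ω u G)
    (hu : IntegrableOn u Ω) (hG : IntegrableOn G Ω) : WeakStarConv Ω (fun _ => u) u :=
  ⟨fun _ => h.mem_BV hu hG, h.mem_BV hu hG, by simp, fun _ => densityMeasure Ω G,
    densityMeasure Ω G, fun _ => h.isDerivMeasure hG, h.isDerivMeasure hG,
    fun _ => tendsto_const_nhds⟩

end Deriv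

/-! ### Lower semicontinuity of convex integrals -/

section LowerSemicontinuity

/-- Jensen's inequality for a mollifier. -/
theorem ofReal_le_lintegral_of_convexOn {α H : Type*} [MeasurableSpace α] {m : Measure α}
    [NormedAddCommGroup H] [NormedSpace ℝ H] [CompleteSpace H] {F : H → ℝ} (hF : Continuous F)
    (hconv : ConvexOn ℝ Set.univ F) (hF0 : ∀ z, 0 ≤ F z) {w : α → ℝ} (hw : Measurable w)
    (hw0 : ∀ x, 0 ≤ w x) (hw1 : ∫⁻ x, ENNReal.ofReal (w x) ∂m = 1) {G : α → H}
    (hGm : AEStronglyMeasurable G m) (hG : Integrable (fun x => w x • G x) m) :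
    ENNReal.ofReal (F (∫ x, w x • G x ∂m)) ≤
      ∫⁻ x, ENNReal.ofReal (w x) * ENNReal.ofReal (F (G x)) ∂m := by
  set P : Measure α := m.withDensity fun x => ENNReal.ofReal (w x) with hP
  have hPp : IsProbabilityMeasure P := ⟨by rw [hP, withDensity_apply _ MeasurableSet.univ]; simpa⟩
  have hac : P ≪ m := withDensity_absolutelyContinuous _ _
  have hwt : ∀ᵐ x ∂m, ENNReal.ofReal (w x) < ⊤ := ae_of_all _ fun x => ENNReal.ofReal_lt_top
  have hFG : AEStronglyMeasurable (fun x => F (G x)) m := hF.comp_aestronglyMeasurable hGm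
  have h1 : ∫ x, G x ∂P = ∫ x, w x • G x ∂m := by
    rw [hP, integral_withDensity_eq_integral_toReal_smul hw.ennreal_ofReal hwt]
    simp only [ENNReal.toReal_ofReal (hw0 _)]
  have h2 : ∫⁻ x, ENNReal.ofReal (F (G x)) ∂P =
      ∫⁻ x, ENNReal.ofReal (w x) * ENNReal.ofReal (F (G x)) ∂m :=
    lintegral_withDensity_eq_lintegral_mul₀ hw.ennreal_ofReal.aemeasurable
      hFG.aemeasurable.ennreal_ofReal
  rw [← h1, ← h2]
  by_cases htop : ∫⁻ x, ENNReal.ofReal (F (G x)) ∂P = ⊤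
  -- An infinite right side leaves nothing to prove; otherwise `F ∘ G` is integrable, as Jensen's
  -- inequality requires.
  · rw [htop]; exact le_top
  have h3 : Integrable G P := by
    rw [hP, integrable_withDensity_iff_integrable_smul' hw.ennreal_ofReal hwt]
    simpa only [ENNReal.toReal_ofReal (hw0 _)] using hG
  have h4 : Integrable (F ∘ G) P := by
    refine ⟨hFG.mono_ac hac, ?_⟩
    exact (hasFiniteIntegral_iff_ofReal (ae_of_all _ fun x => hF0 (G x))).2
      (lt_top_iff_ne_top.2 htop)
  refine le_trans ?_ (ofReal_integral_eq_lintegral_ofReal h4 (ae_of_all _ fun x => hF0 (G x))).le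
  exact ENNReal.ofReal_le_ofReal (hconv.map_integral_le hF.continuousOn isClosed_univ
    (ae_of_all _ fun x => Set.mem_univ _) h3 h4)

variable {n N : ℕ} {Ω : Opens (E n)}

/-- The mollification at `x` of a function given on `Ω`. -/
noncomputable def mollify (Ω : Opens (E n)) (ρ : ContDiffBump (0 : E n)) (G : E n → Mat N n)
    (x : E n) : Mat N n :=
  ∫ y in (Ω : Set (E n)), ρ.normed volume (x - y) • G y

theorem mollify_eq_convolution (ρ : ContDiffBump (0 : E n)) (G : E n → Mat N n) (x : E n) :
    mollify Ω ρ G x = (ρ.normed volume ⋆[ContinuousLinearMap.lsmul ℝ ℝ, volume]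
      (Ω : Set (E n)).indicator G) x := by
  rw [convolution_eq_swap, mollify, ← integral_indicator Ω.isOpen.measurableSet]
  refine integral_congr_ae (ae_of_all _ fun y => ?_)
  by_cases hy : y ∈ (Ω : Set (E n)) <;> simp [hy]

theorem continuous_mollify (ρ : ContDiffBump (0 : E n)) {G : E n → Mat N n}
    (hG : IntegrableOn G Ω) : Continuous (mollify Ω ρ G) := by
  have h : mollify Ω ρ G = (ρ.normed volume ⋆[ContinuousLinearMap.lsmul ℝ ℝ, volume]
      (Ω : Set (E n)).indicator G) := funext fun x => mollify_eq_convolution ρ G x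
  rw [h]
  exact ρ.hasCompactSupport_normed.continuous_convolution_left _
    (ρ.contDiff_normed.continuous (n := 0))
    ((integrable_indicator_iff Ω.isOpen.measurableSet).2 hG).locallyIntegrable

theorem integrableOn_normed_smul (ρ : ContDiffBump (0 : E n)) {G : E n → Mat N n}
    (hG : IntegrableOn G Ω) (x : E n) :
    IntegrableOn (fun y => ρ.normed volume (x - y) • G y) Ω := by
  have hρc : Continuous (ρ.normed (volume : Measure (E n))) := ρ.contDiff_normed.continuous (n := 0)
  obtain ⟨M, hM⟩ := hρc.bounded_above_of_compact_support ρ.hasCompactSupport_normed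
  exact Integrable.bdd_smul hG M (hρc.comp (by fun_prop)).aestronglyMeasurable
    (ae_of_all _ fun y => hM (x - y))

theorem tsupport_normed_const_sub (ρ : ContDiffBump (0 : E n)) (x : E n) :
    tsupport (fun y => ρ.normed volume (x - y)) ⊆ Metric.closedBall x ρ.rOut := by
  refine closure_minimal (fun y hy => ?_) Metric.isClosed_closedBall
  have h1 : x - y ∈ Function.support (ρ.normed volume) := hy
  rw [ρ.support_normed_eq, mem_ball_zero_iff] at h1
  rw [Metric.mem_closedBall, dist_comm, dist_eq_norm]
  exact h1.le

theorem tendsto_integral_inner_of_tendsto_eLpNorm {α H : Type*} [MeasurableSpace α]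
    {m : Measure α} [NormedAddCommGroup H] [InnerProductSpace ℝ H] {U : ℕ → α → H} {u : α → H}
    (hU : ∀ j, Integrable (U j) m) (hu : Integrable u m)
    (h : Tendsto (fun j => eLpNorm (fun x => U j x - u x) 1 m) atTop (𝓝 0)) {ψ : α → H}
    (hψ : AEStronglyMeasurable ψ m) {C : ℝ} (hC : ∀ x, ‖ψ x‖ ≤ C) :
    Tendsto (fun j => ∫ x, inner ℝ (U j x) (ψ x) ∂m) atTop (𝓝 (∫ x, inner ℝ (u x) (ψ x) ∂m)) := by
  have hi : ∀ {v : α → H}, Integrable v m → Integrable (fun x => inner ℝ (v x) (ψ x)) m :=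
    fun {v} hv => by
      simpa only [real_inner_comm] using integrable_inner_of_bound hv hψ hC
  refine tendsto_integral_of_L1 _ (hi hu).aestronglyMeasurable
    (Eventually.of_forall fun j => hi (hU j)) ?_
  have h1 : Tendsto (fun j => ENNReal.ofReal C * eLpNorm (fun x => U j x - u x) 1 m) atTop
      (𝓝 (ENNReal.ofReal C * 0)) := ENNReal.Tendsto.const_mul h (Or.inr ENNReal.ofReal_ne_top)
  rw [mul_zero] at h1
  refine tendsto_of_tendsto_of_tendsto_of_le_of_le tendsto_const_nhds h1 (fun _ => zero_le)
    fun j => ?_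
  simp only [eLpNorm_one_eq_lintegral_enorm]
  rw [← lintegral_const_mul' _ _ ENNReal.ofReal_ne_top]
  refine lintegral_mono fun x => ?_
  rw [← inner_sub_left, mul_comm, ← ofReal_norm, ← ofReal_norm, ← ENNReal.ofReal_mul (norm_nonneg _)]
  exact ENNReal.ofReal_le_ofReal ((norm_inner_le_norm _ _).trans
    (mul_le_mul_of_nonneg_left (hC x) (norm_nonneg _)))

theorem tendsto_integral_inner_rowDiv {U : ℕ → E n → E N} {u : E n → E N}
    (hU : ∀ j, IntegrableOn (U j) Ω) (hu : IntegrableOn u Ω)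
    (h : Tendsto (fun j => eLpNorm (fun x => U j x - u x) 1 (volume.restrict Ω)) atTop (𝓝 0))
    (φ : 𝓓(Ω, Mat N n)) :
    Tendsto (fun j => ∫ x in (Ω : Set (E n)), inner ℝ (U j x) (rowDiv φ x)) atTop
      (𝓝 (∫ x in (Ω : Set (E n)), inner ℝ (u x) (rowDiv φ x))) := by
  obtain ⟨M, hM⟩ := (continuous_rowDiv φ).bounded_above_of_compact_support
    (hasCompactSupport_rowDiv φ)
  exact tendsto_integral_inner_of_tendsto_eLpNorm hU hu h
    (continuous_rowDiv φ).aestronglyMeasurable hM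

/-- When the closed ball lies in `Ω`, `y ↦ ρ(x - y) • c` is a test function. Integrating by parts
moves the derivative from `U j` onto it, and `L¹` convergence suffices. -/
theorem tendsto_mollify {U : ℕ → E n → E N} {u : E n → E N} {G : ℕ → E n → Mat N n}
    {g : E n → Mat N n} (hU : ∀ j, IntegrableOn (U j) Ω) (hu : IntegrableOn u Ω)
    (hG : ∀ j, IntegrableOn (G j) Ω) (hg : IntegrableOn g Ω)
    (hUG : ∀ j, HasWeakGrad Ω (U j) (G j)) (hug : HasWeakGrad Ω u g)
    (h : Tendsto (fun j => eLpNorm (fun x => U j x - u x) 1 (volume.restrict Ω)) atTop (𝓝 0))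
    (ρ : ContDiffBump (0 : E n)) {x : E n} (hx : Metric.closedBall x ρ.rOut ⊆ Ω) :
    Tendsto (fun j => mollify Ω ρ (G j) x) atTop (𝓝 (mollify Ω ρ g x)) := by
  let φ : Mat N n → 𝓓(Ω, Mat N n) := fun c => smulTestFunction
    (fun y => ρ.normed volume (x - y)) (ρ.contDiff_normed.comp (by fun_prop))
    (HasCompactSupport.of_support_subset_isCompact (isCompact_closedBall x ρ.rOut)
      ((subset_tsupport _).trans (tsupport_normed_const_sub ρ x)))
    ((tsupport_normed_const_sub ρ x).trans hx) c
  have h1 : ∀ (c : Mat N n) (v : E n → E N) (w : E n → Mat N n), HasWeakGrad Ω v w →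
      IntegrableOn w Ω → inner ℝ c (mollify Ω ρ w x) =
        -∫ y in (Ω : Set (E n)), inner ℝ (v y) (rowDiv (φ c) y) := by
    intro c v w hvw hw
    rw [hvw.2.2, neg_neg, mollify, ← integral_inner (integrableOn_normed_smul ρ hw x)]
    refine integral_congr_ae (ae_of_all _ fun y => ?_)
    change inner ℝ c (ρ.normed volume (x - y) • w y) = inner ℝ (w y) (ρ.normed volume (x - y) • c)
    rw [inner_smul_right, inner_smul_right, real_inner_comm]
  have h2 : ∀ c : Mat N n, Tendsto (fun j => inner ℝ c (mollify Ω ρ (G j) x)) atTop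
      (𝓝 (inner ℝ c (mollify Ω ρ g x))) := fun c => by
    rw [h1 c u g hug hg]
    refine (tendsto_integral_inner_rowDiv hU hu h (φ c)).neg.congr fun j => ?_
    rw [h1 c _ _ (hUG j) (hG j)]
  rw [(PiLp.homeomorph 2 _).isInducing.tendsto_nhds_iff, tendsto_pi_nhds]
  intro p
  have h3 := h2 (EuclideanSpace.single p 1)
  simp only [EuclideanSpace.inner_single_left, map_one, one_mul] at h3
  exact h3

/-- For `x ∈ A` the whole kernel sits inside `Ω` and has mass one, so Jensen applies pointwise.
After Tonelli, the kernel integrated in `x` over `A` has mass at most one. -/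
theorem lintegral_mollify_le {F : Mat N n → ℝ} (hF : Continuous F)
    (hconv : ConvexOn ℝ Set.univ F) (hF0 : ∀ z, 0 ≤ F z) {G : E n → Mat N n}
    (hG : IntegrableOn G Ω) (ρ : ContDiffBump (0 : E n)) {A : Set (E n)} (hA : MeasurableSet A)
    (hAΩ : ∀ x ∈ A, Metric.closedBall x ρ.rOut ⊆ Ω) :
    ∫⁻ x in A, ENNReal.ofReal (F (mollify Ω ρ G x)) ≤
      ∫⁻ x in (Ω : Set (E n)), ENNReal.ofReal (F (G x)) := by
  have hρc : Continuous (ρ.normed (volume : Measure (E n))) := ρ.contDiff_normed.continuous (n := 0)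
  have hf : AEMeasurable (fun y => ENNReal.ofReal (F (G y))) (volume.restrict (Ω : Set (E n))) :=
    (hF.comp_aestronglyMeasurable hG.aestronglyMeasurable).aemeasurable.ennreal_ofReal
  calc ∫⁻ x in A, ENNReal.ofReal (F (mollify Ω ρ G x))
      ≤ ∫⁻ x in A, ∫⁻ y in (Ω : Set (E n)),
          ENNReal.ofReal (ρ.normed volume (x - y)) * ENNReal.ofReal (F (G y)) := by
        refine setLIntegral_mono' hA fun x hx => ?_
        have hw : Measurable fun y => ρ.normed volume (x - y) :=
          (hρc.comp (by fun_prop : Continuous fun y : E n => x - y)).measurable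
        refine ofReal_le_lintegral_of_convexOn hF hconv hF0 hw (fun y => ρ.nonneg_normed _)
          ?_ hG.aestronglyMeasurable (integrableOn_normed_smul ρ hG x)
        rw [setLIntegral_eq_of_support_subset]
        · rw [lintegral_sub_left_eq_self (fun y => ENNReal.ofReal (ρ.normed volume y)) x]
          exact lintegral_ofReal_normed ρ
        · refine fun y hy => hAΩ x hx (tsupport_normed_const_sub ρ x (subset_tsupport _ ?_))
          exact fun h0 => hy (by simp only [h0, ENNReal.ofReal_zero])
    _ = ∫⁻ y in (Ω : Set (E n)), ∫⁻ x in A,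
          ENNReal.ofReal (ρ.normed volume (x - y)) * ENNReal.ofReal (F (G y)) := by
        refine lintegral_lintegral_swap (AEMeasurable.mul ?_ hf.comp_snd)
        exact (ENNReal.continuous_ofReal.comp
          (hρc.comp (continuous_fst.sub continuous_snd))).measurable.aemeasurable
    _ ≤ ∫⁻ y in (Ω : Set (E n)), ENNReal.ofReal (F (G y)) := by
        refine lintegral_mono fun y => ?_
        dsimp only
        rw [lintegral_mul_const' _ _ ENNReal.ofReal_ne_top]
        refine mul_le_of_le_one_left zero_le ((setLIntegral_le_lintegral _ _).trans ?_)
        rw [lintegral_sub_right_eq_self (fun y => ENNReal.ofReal (ρ.normed volume y)) y,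
          lintegral_ofReal_normed ρ]

theorem closedBall_subset_of_notMem_cthickening {X : Type*} [PseudoMetricSpace X] {s : Set X}
    {x : X} {ε : ℝ} (hx : x ∉ Metric.cthickening ε sᶜ) : Metric.closedBall x ε ⊆ s := by
  intro y hy
  by_contra h
  exact hx (Metric.mem_cthickening_of_dist_le x y ε _ h (by rwa [dist_comm]))

theorem eventually_notMem_cthickening {X : Type*} [PseudoMetricSpace X] {s : Set X}
    (hs : IsOpen s) {x : X} (hx : x ∈ s) {ε : ℕ → ℝ} (hε : Tendsto ε atTop (𝓝 0)) :
    ∀ᶠ k in atTop, x ∉ Metric.cthickening (ε k) sᶜ := by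
  obtain ⟨r, hr, hrs⟩ := Metric.isOpen_iff.1 hs x hx
  filter_upwards [hε.eventually (gt_mem_nhds hr)] with k hk h
  rw [Metric.mem_cthickening_iff] at h
  have h1 : ENNReal.ofReal r ≤ Metric.infEDist x sᶜ := by
    refine Metric.le_infEDist.2 fun y hy => ?_
    rw [edist_dist]
    refine ENNReal.ofReal_le_ofReal ?_
    by_contra h2
    exact hy (hrs (by rw [Metric.mem_ball, dist_comm]; exact not_le.1 h2))
  exact absurd ((ENNReal.ofReal_le_ofReal_iff' ).1 (h1.trans h)) (by
    rintro (h3 | h3) <;> linarith)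

/-- Convex integrals of weak gradients are lower semicontinuous under `L¹` convergence. -/
theorem lintegral_le_liminf_of_tendsto {F : Mat N n → ℝ} (hF : Continuous F)
    (hconv : ConvexOn ℝ Set.univ F) (hF0 : ∀ z, 0 ≤ F z)
    {U : ℕ → E n → E N} {u : E n → E N} {G : ℕ → E n → Mat N n}
    {g : E n → Mat N n} (hU : ∀ j, IntegrableOn (U j) Ω) (hu : IntegrableOn u Ω)
    (hG : ∀ j, IntegrableOn (G j) Ω) (hg : IntegrableOn g Ω)
    (hUG : ∀ j, HasWeakGrad Ω (U j) (G j)) (hug : HasWeakGrad Ω u g)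
    (h : Tendsto (fun j => eLpNorm (fun x => U j x - u x) 1 (volume.restrict Ω)) atTop (𝓝 0)) :
    ∫⁻ x in (Ω : Set (E n)), ENNReal.ofReal (F (g x)) ≤
      liminf (fun j => ∫⁻ x in (Ω : Set (E n)), ENNReal.ofReal (F (G j x))) atTop := by
  set L := liminf (fun j => ∫⁻ x in (Ω : Set (E n)), ENNReal.ofReal (F (G j x))) atTop with hL
  let ε : ℕ → ℝ := fun k => 1 / ((k : ℝ) + 1)
  have hε0 : ∀ k, 0 < ε k := fun k => Nat.one_div_pos_of_nat
  have hε : Tendsto ε atTop (𝓝 0) := tendsto_one_div_add_atTop_nhds_zero_nat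
  let ρ : ℕ → ContDiffBump (0 : E n) := fun k =>
    ⟨ε k / 2, ε k, half_pos (hε0 k), half_lt_self (hε0 k)⟩
  -- The points of `Ω` farther than `ε k` from its complement, where the mollifier stays inside `Ω`.
  -- Each point of `Ω` eventually lies in `A k`.
  let A : ℕ → Set (E n) := fun k => (Metric.cthickening (ε k) (Ω : Set (E n))ᶜ)ᶜ
  have hA : ∀ k, MeasurableSet (A k) := fun k =>
    Metric.isClosed_cthickening.measurableSet.compl
  have hAΩ : ∀ k, ∀ x ∈ A k, Metric.closedBall x (ρ k).rOut ⊆ Ω := fun k x hx =>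
    closedBall_subset_of_notMem_cthickening hx
  have hm : ∀ (k : ℕ) {w : E n → Mat N n}, IntegrableOn w Ω →
      Measurable fun x => ENNReal.ofReal (F (mollify Ω (ρ k) w x)) := fun k w hw =>
    (hF.comp (continuous_mollify (ρ k) hw)).measurable.ennreal_ofReal
  have h1 : ∀ k, ∫⁻ x in A k, ENNReal.ofReal (F (mollify Ω (ρ k) g x)) ≤ L := by
    intro k
    calc ∫⁻ x in A k, ENNReal.ofReal (F (mollify Ω (ρ k) g x))
        = ∫⁻ x in A k, liminf (fun j => ENNReal.ofReal (F (mollify Ω (ρ k) (G j) x))) atTop := by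
          refine setLIntegral_congr_fun (hA k) fun x hx => ?_
          refine (Tendsto.liminf_eq ?_).symm
          exact ENNReal.tendsto_ofReal ((hF.tendsto _).comp
            (tendsto_mollify hU hu hG hg hUG hug h (ρ k) (hAΩ k x hx)))
      _ ≤ liminf (fun j => ∫⁻ x in A k, ENNReal.ofReal (F (mollify Ω (ρ k) (G j) x))) atTop :=
          lintegral_liminf_le fun j => hm k (hG j)
      _ ≤ L := liminf_le_liminf (Eventually.of_forall fun j =>
          lintegral_mollify_le hF hconv hF0 (hG j) (ρ k) (hA k) (hAΩ k))
  have h2 : ∀ᵐ x ∂(volume.restrict (Ω : Set (E n))), ENNReal.ofReal (F (g x)) =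
      liminf (fun k => (A k).indicator
        (fun x => ENNReal.ofReal (F (mollify Ω (ρ k) g x))) x) atTop := by
    rw [ae_restrict_iff' Ω.isOpen.measurableSet]
    -- Almost everywhere convergence of mollifications needs the outer radius bounded by a multiple
    -- of the inner one; the bumps were built with ratio `2`.
    have h3 := ContDiffBump.ae_convolution_tendsto_right_of_locallyIntegrable
      (μ := (volume : Measure (E n))) (φ := ρ) (l := atTop) (K := 2)
      (g := (Ω : Set (E n)).indicator g) hε (Eventually.of_forall fun k => by
        change ε k ≤ 2 * (ε k / 2); linarith)
      ((integrable_indicator_iff Ω.isOpen.measurableSet).2 hg).locallyIntegrable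
    filter_upwards [h3] with x hx hxΩ
    simp only [← mollify_eq_convolution, Set.indicator_of_mem hxΩ] at hx
    refine (Tendsto.liminf_eq ?_).symm
    refine (ENNReal.tendsto_ofReal ((hF.tendsto _).comp hx)).congr' ?_
    filter_upwards [eventually_notMem_cthickening Ω.isOpen hxΩ hε] with k hk
    rw [Set.indicator_of_mem (show x ∈ A k from hk)]
    rfl
  -- Second use of Fatou, now as `k → ∞`; every member of the resulting sequence is at most `L` by
  -- `h1`.
  rw [lintegral_congr_ae h2]
  refine (lintegral_liminf_le fun k => (hm k hg).indicator (hA k)).trans ?_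
  refine liminf_le_of_le (by isBoundedDefault) fun b hb => ?_
  obtain ⟨k, hk⟩ := hb.exists
  refine hk.trans ((setLIntegral_le_lintegral _ _).trans ?_)
  rw [lintegral_indicator (hA k)]
  exact h1 k

end LowerSemicontinuity

/-! ### Compactness in `BV` of a Dirichlet class -/

section Compactness

variable {n N : ℕ} {Ω : Opens (E n)}

theorem eq_sum_smul_single {ι : Type*} [Fintype ι] [DecidableEq ι] (x : EuclideanSpace ℝ ι) :
    x = ∑ i, x i • (EuclideanSpace.single i 1 : EuclideanSpace ℝ ι) := by
  ext j
  simp [Finset.sum_apply, Pi.single_apply]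

theorem norm_le_sum_abs {ι : Type*} [Fintype ι] (x : EuclideanSpace ℝ ι) : ‖x‖ ≤ ∑ i, |x i| := by
  classical
  calc ‖x‖ = ‖∑ i, x i • (EuclideanSpace.single i 1 : EuclideanSpace ℝ ι)‖ := by
        rw [← eq_sum_smul_single]
    _ ≤ ∑ i, |x i| := (norm_sum_le _ _).trans (Finset.sum_le_sum fun i _ => by simp [norm_smul])

theorem continuous_grad (φ : 𝓓(Ω, E N)) : Continuous (grad φ) := by
  have h : Continuous (fderiv ℝ φ) := φ.contDiff.continuous_fderiv (by simp)
  unfold grad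
  refine (PiLp.continuous_toLp 2 _).comp (continuous_pi fun p => ?_)
  exact (PiLp.continuous_apply 2 _ p.1).comp (h.clm_apply continuous_const)

theorem grad_eq_zero_of_notMem (φ : 𝓓(Ω, E N)) {x : E n} (hx : x ∉ Ω) : grad φ x = 0 := by
  have : fderiv ℝ φ x = 0 := by
    by_contra h'
    exact hx (φ.tsupport_subset (support_fderiv_subset ℝ h'))
  ext p
  simp [grad, this]

theorem contDiff_testFunction_apply (φ : 𝓓(Ω, E N)) (i : Fin N) :
    ContDiff ℝ 1 fun x => φ x i :=
  (EuclideanSpace.proj (𝕜 := ℝ) i).contDiff.comp (φ.contDiff.of_le (by simp))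

/-- Each partial derivative of the component is an entry of `grad φ x`; summing crudely over the `n`
directions gives the factor `n`. -/
theorem norm_fderiv_apply_le (φ : 𝓓(Ω, E N)) (i : Fin N) (x : E n) :
    ‖fderiv ℝ (fun x => φ x i) x‖ ≤ n * ‖grad φ x‖ := by
  have hd : DifferentiableAt ℝ φ x := (φ.contDiff.differentiable (by simp)) x
  have h1 : ∀ v, fderiv ℝ (fun x => φ x i) x v = fderiv ℝ φ x v i := by
    intro v
    let L : E N →L[ℝ] ℝ := EuclideanSpace.proj i
    have h2 : fderiv ℝ (L ∘ φ) x = L ∘L fderiv ℝ φ x := (L.hasFDerivAt.comp x hd.hasFDerivAt).fderiv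
    change fderiv ℝ (L ∘ φ) x v = _
    rw [h2]
    rfl
  refine ContinuousLinearMap.opNorm_le_bound _ (by positivity) fun v => ?_
  calc ‖fderiv ℝ (fun x => φ x i) x v‖
      = ‖∑ k, v k • fderiv ℝ (fun x => φ x i) x (EuclideanSpace.single k 1)‖ := by
        conv_lhs => rw [eq_sum_smul_single v]
        simp only [map_sum, map_smul]
    _ ≤ ∑ k : Fin n, ‖v‖ * ‖grad φ x‖ := by
        refine (norm_sum_le _ _).trans (Finset.sum_le_sum fun k _ => ?_)
        rw [norm_smul, h1]
        refine mul_le_mul (PiLp.norm_apply_le v k) ?_ (norm_nonneg _) (norm_nonneg _)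
        exact PiLp.norm_apply_le (grad φ x) (i, k)
    _ = n * ‖grad φ x‖ * ‖v‖ := by
        simp only [Finset.sum_const, Finset.card_univ, Fintype.card_fin, nsmul_eq_mul]
        ring

theorem lintegral_enorm_fderiv_apply_le (φ : 𝓓(Ω, E N)) (i : Fin N) :
    ∫⁻ x, ‖fderiv ℝ (fun x => φ x i) x‖ₑ ≤ n * eLpNorm (grad φ) 1 (volume.restrict Ω) := by
  rw [eLpNorm_one_eq_lintegral_enorm, ← lintegral_const_mul' _ _ (by simp),
    setLIntegral_eq_of_support_subset]
  · refine lintegral_mono fun x => ?_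
    rw [← ofReal_norm, ← ofReal_norm, ← ENNReal.ofReal_natCast, ← ENNReal.ofReal_mul (by positivity)]
    exact ENNReal.ofReal_le_ofReal (norm_fderiv_apply_le φ i x)
  · intro x hx
    by_contra h
    exact hx (by simp [grad_eq_zero_of_notMem φ h])

theorem tendsto_eLpNorm_one_of_tendsto_eLpNorm {α H : Type*} [MeasurableSpace α] {m : Measure α}
    [IsFiniteMeasure m] [NormedAddCommGroup H] {p : ℝ≥0∞} (hp : 1 ≤ p) {f : ℕ → α → H}
    (hf : ∀ j, AEStronglyMeasurable (f j) m)
    (h : Tendsto (fun j => eLpNorm (f j) p m) atTop (𝓝 0)) :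
    Tendsto (fun j => eLpNorm (f j) 1 m) atTop (𝓝 0) := by
  have h1 : Tendsto (fun j => eLpNorm (f j) p m *
      m Set.univ ^ (1 / (1 : ℝ≥0∞).toReal - 1 / p.toReal)) atTop (𝓝 (0 *
      m Set.univ ^ (1 / (1 : ℝ≥0∞).toReal - 1 / p.toReal))) := by
    refine ENNReal.Tendsto.mul_const h (Or.inr ?_)
    refine (ENNReal.rpow_lt_top_of_nonneg ?_ (measure_ne_top _ _)).ne
    rcases eq_or_ne p ⊤ with rfl | hp'
    · simp
    · have : 1 ≤ p.toReal := by simpa using ENNReal.toReal_mono hp' hp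
      simp only [ENNReal.toReal_one, div_one, sub_nonneg]
      exact div_le_one_of_le₀ this (by linarith)
  rw [zero_mul] at h1
  exact tendsto_of_tendsto_of_tendsto_of_le_of_le tendsto_const_nhds h1 (fun _ => zero_le)
    fun j => eLpNorm_le_eLpNorm_mul_rpow_measure_univ hp (hf j)

/-- Since `Ω` has finite measure, the `L^q` approximation in the definition is also an `L¹`
approximation, the only norm used for compactness. -/
theorem MemW10.exists_testFunction (hΩ : Bornology.IsBounded (Ω : Set (E n))) {q : ℝ} (hq : 1 ≤ q)
    {v : E n → E N} (h : MemW10 q Ω v) {ε : ℝ≥0∞} (hε : 0 < ε) :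
    ∃ φ : 𝓓(Ω, E N), eLpNorm (fun x => φ x - v x) 1 (volume.restrict Ω) < ε ∧
      eLpNorm (fun x => grad φ x - weakGrad Ω v x) 1 (volume.restrict Ω) < ε := by
  have := isFiniteMeasure_restrict_of_isBounded hΩ
  obtain ⟨hv, φ, h1, h2⟩ := h
  have hq' : 1 ≤ ENNReal.ofReal q := by simpa using hq
  have h3 := tendsto_eLpNorm_one_of_tendsto_eLpNorm hq' (fun j =>
    (φ j).continuous.aestronglyMeasurable.sub hv.1.aestronglyMeasurable) h1
  have h4 := tendsto_eLpNorm_one_of_tendsto_eLpNorm hq' (fun j =>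
    (continuous_grad (φ j)).aestronglyMeasurable.sub hv.memLp_weakGrad.aestronglyMeasurable) h2
  obtain ⟨j, h5, h6⟩ :=
    ((h3.eventually (gt_mem_nhds hε)).and (h4.eventually (gt_mem_nhds hε))).exists
  exact ⟨φ j, h5, h6⟩

/-- Gradient bounds give strong `L¹` compactness in a Dirichlet class. -/
theorem exists_subseq_tendsto_eLpNorm (hn : n ≠ 0) (hΩ : Bornology.IsBounded (Ω : Set (E n)))
    {q : ℝ} (hq : 1 ≤ q) {u₀ : E n → E N} (hu₀ : MemW1 q Ω u₀) {U : ℕ → E n → E N}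
    (hU : ∀ j, U j ∈ dirichletClass q Ω u₀) {C : ℝ}
    (hC : ∀ j, eLpNorm (weakGrad Ω (U j)) 1 (volume.restrict Ω) ≤ ENNReal.ofReal C) :
    ∃ s : ℕ → ℕ, StrictMono s ∧ ∃ u : E n → E N, IntegrableOn u Ω ∧
      Tendsto (fun j => eLpNorm (fun x => U (s j) x - u x) 1 (volume.restrict Ω)) atTop (𝓝 0) := by
  -- Makes `E n` nontrivial, so that the Poincaré inequality has a direction in which to translate.
  have : Nonempty (Fin n) := Fin.pos_iff_nonempty.1 (Nat.pos_of_ne_zero hn)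
  have hfin := isFiniteMeasure_restrict_of_isBounded hΩ
  obtain ⟨R', hR'⟩ := hΩ.subset_closedBall 0
  set R := max R' 0
  have hR : (Ω : Set (E n)) ⊆ Metric.closedBall 0 R :=
    hR'.trans (Metric.closedBall_subset_closedBall (le_max_left _ _))
  have hUW := fun j => memW1_of_mem_dirichletClass hu₀ (hU j)
  have hpos : ∀ j : ℕ, (0 : ℝ≥0∞) < ENNReal.ofReal (1 / ((j : ℝ) + 1)) := fun j => by positivity
  choose φ hφ1 hφ2 using fun j => (hU j).exists_testFunction hΩ hq (hpos j)
  -- The `1` absorbs the approximation error `1 / (j + 1)`; the rest bounds the gradient of `U j -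
  -- u₀`.
  set D : ℝ≥0∞ := 1 + (ENNReal.ofReal C + eLpNorm (weakGrad Ω u₀) 1 (volume.restrict Ω)) with hD
  have hu₀1 : eLpNorm (weakGrad Ω u₀) 1 (volume.restrict Ω) ≠ ⊤ :=
    (memLp_one_iff_integrable.2 (hu₀.integrableOn_weakGrad hΩ hq)).2.ne
  have hgrad : ∀ j, eLpNorm (grad (φ j)) 1 (volume.restrict Ω) ≤ D := by
    intro j
    set v := fun x => U j x - u₀ x with hv
    have hvW : MemW1 q Ω v := (hU j).1
    have h1 : weakGrad Ω (U j) =ᵐ[volume.restrict Ω] fun x => weakGrad Ω v x + weakGrad Ω u₀ x := by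
      have := weakGrad_add_ae_eq hvW hu₀
      simpa [hv] using this
    have h2 : weakGrad Ω v =ᵐ[volume.restrict Ω] weakGrad Ω (U j) - weakGrad Ω u₀ := by
      filter_upwards [h1] with x hx
      simp [hx]
    have hm1 : AEStronglyMeasurable (weakGrad Ω v) (volume.restrict Ω) :=
      hvW.memLp_weakGrad.aestronglyMeasurable
    have h3 : grad (φ j) = (fun x => grad (φ j) x - weakGrad Ω v x) + weakGrad Ω v := by
      ext1 x; simp
    rw [h3]
    refine (eLpNorm_add_le ((continuous_grad (φ j)).aestronglyMeasurable.sub hm1) hm1 le_rfl).trans ?_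
    refine add_le_add ((hφ2 j).le.trans ?_) ?_
    · rw [← ENNReal.ofReal_one]
      refine ENNReal.ofReal_le_ofReal ?_
      exact div_le_one_of_le₀ (by simp) (by positivity)
    · rw [eLpNorm_congr_ae h2]
      refine (eLpNorm_sub_le (hUW j).memLp_weakGrad.aestronglyMeasurable
        hu₀.memLp_weakGrad.aestronglyMeasurable le_rfl).trans ?_
      gcongr
      exact hC j
  have hnD : (n : ℝ≥0∞) * D ≠ ⊤ := by
    refine ENNReal.mul_ne_top (by simp) ?_
    simp [hD, hu₀1]
  obtain ⟨s, hs, g, hg, hgs⟩ := exists_subseq_tendsto_lintegral_enorm_sub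
    (μ := (volume : Measure (E n))) (R := R) (C := (n * D).toReal) (le_max_right _ _)
    (fun (i : Fin N) j x => φ j x i) (fun i j => contDiff_testFunction_apply (φ j) i)
    (fun i j x hx => by
      have : φ j x = 0 := image_eq_zero_of_notMem_tsupport fun h =>
        hx (hR ((φ j).tsupport_subset h))
      simp [this])
    (fun i j => by
      rw [ENNReal.ofReal_toReal hnD]
      refine (lintegral_enorm_fderiv_apply_le (φ j) i).trans ?_
      gcongr
      exact hgrad j)
  let w : E n → E N := fun x => WithLp.toLp 2 fun i => g i x
  have hw : Integrable w := by
    have h1 : w = fun x => ∑ i, g i x • (EuclideanSpace.single i 1 : E N) :=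
      funext fun x => eq_sum_smul_single (w x)
    rw [h1]
    exact integrable_finsetSum _ fun i _ => (hg i).smul_const _
  -- `w` is the `L¹` limit of the test functions approximating `U j - u₀`, so adding back `u₀` gives
  -- the limit of `U j`.
  refine ⟨s, hs, fun x => u₀ x + w x, (hu₀.integrableOn hΩ hq).add hw.integrableOn, ?_⟩
  have hsum : Tendsto (fun j => ENNReal.ofReal (1 / (((s j : ℕ) : ℝ) + 1)) +
      ∑ i, ∫⁻ x, ‖φ (s j) x i - g i x‖ₑ) atTop (𝓝 (0 + ∑ i : Fin N, 0)) := by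
    refine Tendsto.add ?_ (tendsto_finsetSum _ fun i _ => hgs i)
    have := ENNReal.tendsto_ofReal (tendsto_one_div_add_atTop_nhds_zero_nat (𝕜 := ℝ))
    rw [ENNReal.ofReal_zero] at this
    exact this.comp hs.tendsto_atTop
  simp only [Finset.sum_const_zero, add_zero] at hsum
  refine tendsto_of_tendsto_of_tendsto_of_le_of_le tendsto_const_nhds hsum (fun _ => zero_le)
    fun j => ?_
  have h1 : (fun x => U (s j) x - (u₀ x + w x)) =
      (fun x => φ (s j) x - w x) - fun x => φ (s j) x - (U (s j) x - u₀ x) := by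
    ext1 x
    simp only [Pi.sub_apply]
    abel
  have hmφ : AEStronglyMeasurable (φ (s j)) (volume.restrict (Ω : Set (E n))) :=
    (φ (s j)).continuous.aestronglyMeasurable
  dsimp only
  rw [h1, add_comm]
  refine (eLpNorm_sub_le (hmφ.sub hw.aestronglyMeasurable.restrict)
    (hmφ.sub (hU (s j)).1.1.aestronglyMeasurable) le_rfl).trans (add_le_add ?_ (hφ1 (s j)).le)
  rw [eLpNorm_one_eq_lintegral_enorm]
  refine (setLIntegral_le_lintegral _ _).trans ?_
  rw [← lintegral_finsetSum']
  · refine lintegral_mono fun x => ?_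
    simp only [← ofReal_norm, Real.norm_eq_abs]
    rw [← ENNReal.ofReal_sum_of_nonneg fun i _ => abs_nonneg _]
    exact ENNReal.ofReal_le_ofReal (norm_le_sum_abs _)
  · intro i _
    exact ((contDiff_testFunction_apply (φ (s j)) i).continuous.aestronglyMeasurable.sub
      (hg i).aestronglyMeasurable).enorm

theorem integrableOn_apply {G : E n → Mat N n} (hG : IntegrableOn G Ω) (p : Fin N × Fin n) :
    IntegrableOn (fun x => G x p) Ω :=
  (EuclideanSpace.proj (𝕜 := ℝ) p).integrable_comp hG

/-- Gradient bounds give weak-star compactness in a Dirichlet class. -/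
theorem exists_subseq_weakStarConv (hn : n ≠ 0) (hΩ : Bornology.IsBounded (Ω : Set (E n)))
    {q : ℝ} (hq : 1 ≤ q) {u₀ : E n → E N} (hu₀ : MemW1 q Ω u₀) {U : ℕ → E n → E N}
    (hU : ∀ j, U j ∈ dirichletClass q Ω u₀) {C : ℝ}
    (hC : ∀ j, eLpNorm (weakGrad Ω (U j)) 1 (volume.restrict Ω) ≤ ENNReal.ofReal C) :
    ∃ s : ℕ → ℕ, StrictMono s ∧ ∃ u : E n → E N, WeakStarConv Ω (fun j => U (s j)) u := by
  obtain ⟨s, hs, u, hu, hsu⟩ := exists_subseq_tendsto_eLpNorm hn hΩ hq hu₀ hU hC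
  obtain ⟨R, hR⟩ := hΩ.subset_closedBall 0
  have hUW := fun j => memW1_of_mem_dirichletClass hu₀ (hU j)
  have hUi := fun j => (hUW j).integrableOn hΩ hq
  have hGi := fun j => (hUW j).integrableOn_weakGrad hΩ hq
  have hUG := fun j => (hUW j).hasWeakGrad
  have hC' : ∀ j, ∫ x in (Ω : Set (E n)), ‖weakGrad Ω (U j) x‖ ≤ max C 0 := fun j => by
    rw [← ENNReal.ofReal_le_ofReal_iff (le_max_right _ _), ofReal_integral_norm_eq_lintegral_enorm
      (hGi j), ← eLpNorm_one_eq_lintegral_enorm]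
    exact (hC j).trans (ENNReal.ofReal_le_ofReal (le_max_left _ _))
  obtain ⟨t, ht, ν, κ, hνκ⟩ := exists_subseq_tendsto_integral_mul (m := (volume : Measure (E n)))
    (isCompact_closedBall (0 : E n) R) (C := max C 0)
    (fun (p : Fin N × Fin n) j => (Ω : Set (E n)).indicator fun x => weakGrad Ω (U (s j)) x p)
    (fun p j => (integrable_indicator_iff Ω.isOpen.measurableSet).2 (integrableOn_apply (hGi _) p))
    (fun p j x hx => Set.indicator_of_notMem (fun h => hx (hR h)) _)
    (fun p j => by
      refine le_trans ?_ (hC' (s j))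
      rw [← integral_indicator Ω.isOpen.measurableSet]
      refine integral_mono
        ((integrable_indicator_iff Ω.isOpen.measurableSet).2 (integrableOn_apply (hGi _) p)).abs
        ((integrable_indicator_iff Ω.isOpen.measurableSet).2 (hGi _).norm) fun x => ?_
      by_cases hx : x ∈ (Ω : Set (E n))
      · simp only [Set.indicator_of_mem hx]
        exact PiLp.norm_apply_le (weakGrad Ω (U (s j)) x) p
      · simp [Set.indicator_of_notMem hx])
  have hconv : ∀ Φ : E n →ᵇ Mat N n, (∀ x ∉ Ω, Φ x = 0) →
      Tendsto (fun j => pairing (fun x : Ω => Φ x) (densityMeasure Ω (weakGrad Ω (U (s (t j))))))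
        atTop (𝓝 (pairing (fun x : Ω => Φ x) (entryMeasure Ω ν κ))) := by
    intro Φ hΦ
    rw [pairing_entryMeasure ν κ Φ hΦ]
    let ψ : Fin N × Fin n → (E n →ᵇ ℝ) := fun p =>
      BoundedContinuousFunction.ofNormedAddCommGroup (fun x => Φ x p)
        ((PiLp.continuous_apply 2 _ p).comp Φ.continuous) ‖Φ‖
        fun x => (PiLp.norm_apply_le (Φ x) p).trans (Φ.norm_coe_le_norm x)
    have h1 := tendsto_finsetSum Finset.univ fun p _ => hνκ p (ψ p)
    refine h1.congr fun j => ?_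
    rw [pairing_densityMeasure (hGi _), ← integral_indicator Ω.isOpen.measurableSet,
      ← integral_finsetSum]
    · refine integral_congr_ae (ae_of_all _ fun x => ?_)
      by_cases hx : x ∈ (Ω : Set (E n))
      · simp only [Set.indicator_of_mem hx, PiLp.inner_apply]
        exact Finset.sum_congr rfl fun p _ => by simp [ψ, mul_comm]
      · simp [Set.indicator_of_notMem hx]
    · intro p _
      exact ((integrable_indicator_iff Ω.isOpen.measurableSet).2
        (integrableOn_apply (hGi _) p)).bdd_mul (ψ p).continuous.aestronglyMeasurable
        (ae_of_all _ fun x => (ψ p).norm_coe_le_norm x)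
  have hL1 := hsu.comp ht.tendsto_atTop
  have hrow : ∀ φ : 𝓓(Ω, Mat N n), Tendsto
      (fun j => ∫ x in (Ω : Set (E n)), inner ℝ (U (s (t j)) x) (rowDiv φ x)) atTop
      (𝓝 (∫ x in (Ω : Set (E n)), inner ℝ (u x) (rowDiv φ x))) := fun φ =>
    tendsto_integral_inner_rowDiv (fun j => hUi _) hu hL1 φ
  refine ⟨s ∘ t, hs.comp ht, u, fun j => (hUG _).mem_BV (hUi _) (hGi _), ⟨hu, ?_⟩, hL1,
    fun j => densityMeasure Ω (weakGrad Ω (U (s (t j)))), entryMeasure Ω ν κ,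
    fun j => (hUG _).isDerivMeasure (hGi _), fun φ => ?_, fun φ => ?_⟩
  · refine (totalVariation_le_ofReal (C := max C 0) fun φ hφ => ?_).trans_lt ENNReal.ofReal_lt_top
    exact le_of_tendsto' (hrow φ) fun j =>
      ((hUG _).integral_inner_rowDiv_le (hGi _) φ hφ).trans (hC' _)
  -- The limit measure is `Du`: both sides of the integration by parts formula converge, one by `L¹`
  -- convergence and the other by weak convergence of the gradients.
  · refine tendsto_nhds_unique (hrow φ) ?_
    have h1 := (hconv (testFunctionToBCF φ) fun x hx =>
      image_eq_zero_of_notMem_tsupport fun h => hx (φ.tsupport_subset h)).neg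
    exact h1.congr fun j => ((hUG _).isDerivMeasure (hGi _) φ).symm
  · obtain ⟨Φ, hΦ1, hΦ0⟩ := exists_boundedContinuousFunction_extend φ
    have h1 : (φ : Ω → Mat N n) = fun x : Ω => Φ x := funext fun x => (hΦ1 x).symm
    rw [h1]
    exact hconv Φ hΦ0

end Compactness

/-! ### The relaxed functional: consistency on the Dirichlet class and the direct method. -/

section Relaxation

variable {n N : ℕ} {Ω : Opens (E n)} {q : ℝ} {F : Mat N n → ℝ} {u₀ : E n → E N}

theorem energy_eq_relaxedEnergy (hΩ : Bornology.IsBounded (Ω : Set (E n))) (hq : 1 ≤ q)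
    (hF : Continuous F) (hconv : ConvexOn ℝ Set.univ F) (hF0 : ∀ z, 0 ≤ F z)
    (hu₀ : MemW1 q Ω u₀) {u : E n → E N} (hu : u ∈ dirichletClass q Ω u₀) :
    energy Ω F u = relaxedEnergy q Ω F u₀ u := by
  have huW := memW1_of_mem_dirichletClass hu₀ hu
  refine le_antisymm (le_sInf ?_) (sInf_le ⟨fun _ => u, fun _ => hu,
    weakStarConv_const huW.hasWeakGrad (huW.integrableOn hΩ hq) (huW.integrableOn_weakGrad hΩ hq),
    (liminf_const _).symm⟩)
  rintro _ ⟨U, hU, hUu, rfl⟩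
  have hUW := fun j => memW1_of_mem_dirichletClass hu₀ (hU j)
  exact lintegral_le_liminf_of_tendsto hF hconv hF0 (fun j => (hUW j).integrableOn hΩ hq)
    (huW.integrableOn hΩ hq) (fun j => (hUW j).integrableOn_weakGrad hΩ hq)
    (huW.integrableOn_weakGrad hΩ hq) (fun j => (hUW j).hasWeakGrad) huW.hasWeakGrad hUu.2.2.1

/-- Every competing sequence stays in the Dirichlet class, so each of its energies is already at
least the infimum. -/
theorem sInf_energy_le_relaxedEnergy (u : E n → E N) :
    sInf (energy Ω F '' dirichletClass q Ω u₀) ≤ relaxedEnergy q Ω F u₀ u := by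
  refine le_sInf ?_
  rintro _ ⟨U, hU, -, rfl⟩
  exact le_liminf_of_le (by isBoundedDefault)
    (Eventually.of_forall fun j => sInf_le (Set.mem_image_of_mem _ (hU j)))

theorem eLpNorm_weakGrad_le_energy {γ : ℝ} (hγ : 0 < γ) (hF : ∀ z, γ * ‖z‖ ≤ F z)
    (u : E n → E N) :
    eLpNorm (weakGrad Ω u) 1 (volume.restrict Ω) ≤ ENNReal.ofReal γ⁻¹ * energy Ω F u := by
  rw [eLpNorm_one_eq_lintegral_enorm, energy, ← lintegral_const_mul' _ _ ENNReal.ofReal_ne_top]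
  refine lintegral_mono fun x => ?_
  rw [← ofReal_norm, ← ENNReal.ofReal_mul (by positivity)]
  refine ENNReal.ofReal_le_ofReal ?_
  rw [inv_mul_eq_div, le_div_iff₀' hγ]
  exact hF _

theorem exists_relaxedEnergy_le_sInf_energy (hΩ : Bornology.IsBounded (Ω : Set (E n)))
    (hq : 1 ≤ q) {γ Γ : ℝ} (hγ : 0 < γ) (hF : Continuous F) (hconv : ConvexOn ℝ Set.univ F)
    (hgrowth : ∀ z, γ * ‖z‖ ≤ F z ∧ F z ≤ Γ * (1 + ‖z‖ ^ q)) (hu₀ : MemW1 q Ω u₀) :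
    ∃ u ∈ BV N Ω, relaxedEnergy q Ω F u₀ u ≤ sInf (energy Ω F '' dirichletClass q Ω u₀) := by
  have hF0 : ∀ z, 0 ≤ F z := fun z => (by positivity : 0 ≤ γ * ‖z‖).trans (hgrowth z).1
  have hu₀D : u₀ ∈ dirichletClass q Ω u₀ := self_mem_dirichletClass q u₀
  -- In dimension zero matrices have no entries, so all energies coincide and `u₀` itself is a
  -- minimizer.
  rcases eq_or_ne n 0 with rfl | hn
  · refine ⟨u₀, hu₀.hasWeakGrad.mem_BV (hu₀.integrableOn hΩ hq)
      (hu₀.integrableOn_weakGrad hΩ hq), ?_⟩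
    rw [← energy_eq_relaxedEnergy hΩ hq hF hconv hF0 hu₀ hu₀D]
    refine le_sInf ?_
    rintro _ ⟨v, -, rfl⟩
    rw [energy, energy, Subsingleton.elim (weakGrad Ω u₀) (weakGrad Ω v)]
  obtain ⟨e, hanti, hlim, he⟩ := exists_seq_tendsto_sInf
    (S := energy Ω F '' dirichletClass q Ω u₀) ⟨_, Set.mem_image_of_mem _ hu₀D⟩ (OrderBot.bddBelow _)
  choose U hU hUe using he
  -- The minimizing sequence of energies is antitone, so its finite first value bounds them all and,
  -- after division by `γ`, all the gradients in `L¹`.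
  have he0 : e 0 < ⊤ := by
    rw [← hUe 0]
    exact energy_lt_top hΩ hq (memW1_of_mem_dirichletClass hu₀ (hU 0)) fun z => (hgrowth z).2
  have hfin : ENNReal.ofReal γ⁻¹ * e 0 ≠ ⊤ := ENNReal.mul_ne_top ENNReal.ofReal_ne_top he0.ne
  obtain ⟨s, hs, u, hu⟩ := exists_subseq_weakStarConv hn hΩ hq hu₀ hU
    (C := (ENNReal.ofReal γ⁻¹ * e 0).toReal) fun j => by
      rw [ENNReal.ofReal_toReal hfin]
      refine (eLpNorm_weakGrad_le_energy hγ (fun z => (hgrowth z).1) (U j)).trans ?_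
      rw [hUe]
      gcongr
      exact hanti (Nat.zero_le j)
  -- The extracted subsequence is itself a competitor for `u`, and its lower limit is the infimum.
  refine ⟨u, hu.2.1, sInf_le ⟨fun j => U (s j), fun j => hU _, hu, ?_⟩⟩
  simp only [hUe]
  exact ((hlim.comp hs.tendsto_atTop).liminf_eq).symm

end Relaxation

end LSM

theorem theorem4p4 (n N : ℕ) (Ω : Opens (LSM.E n))
    (hΩ : Bornology.IsBounded (Ω : Set (LSM.E n))) (hLip : LSM.HasLipschitzBoundary Ω)
    (q γ Γ : ℝ) (hq : 1 ≤ q) (hγ : 0 < γ) (hγΓ : γ ≤ Γ)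
    (F : LSM.Mat N n → ℝ) (hF : Continuous F) (hconv : ConvexOn ℝ Set.univ F)
    (hgrowth : ∀ z, γ * ‖z‖ ≤ F z ∧ F z ≤ Γ * (1 + ‖z‖ ^ q))
    (u₀ : LSM.E n → LSM.E N) (hu₀ : LSM.MemW1 q Ω u₀) :
    (∀ u ∈ LSM.dirichletClass q Ω u₀,
      LSM.energy Ω F u = LSM.relaxedEnergy q Ω F u₀ u) ∧
    ∃ m : ℝ≥0,
      IsGLB (LSM.energy Ω F '' LSM.dirichletClass q Ω u₀) (m : ℝ≥0∞) ∧
      IsLeast (LSM.relaxedEnergy q Ω F u₀ '' LSM.BV N Ω) (m : ℝ≥0∞) := by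
  have hF0 : ∀ z, 0 ≤ F z := fun z => (by positivity : 0 ≤ γ * ‖z‖).trans (hgrowth z).1
  refine ⟨fun u hu => LSM.energy_eq_relaxedEnergy hΩ hq hF hconv hF0 hu₀ hu, ?_⟩
  have hfin : sInf (LSM.energy Ω F '' LSM.dirichletClass q Ω u₀) ≠ ⊤ :=
    ((sInf_le (Set.mem_image_of_mem _ (LSM.self_mem_dirichletClass q u₀))).trans_lt
      (LSM.energy_lt_top hΩ hq hu₀ fun z => (hgrowth z).2)).ne
  refine ⟨(sInf (LSM.energy Ω F '' LSM.dirichletClass q Ω u₀)).toNNReal, ?_⟩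
  rw [ENNReal.coe_toNNReal hfin]
  refine ⟨isGLB_sInf _, ?_, ?_⟩
  · obtain ⟨u, hu, hle⟩ :=
      LSM.exists_relaxedEnergy_le_sInf_energy hΩ hq hγ hF hconv hgrowth hu₀
    exact ⟨u, hu, le_antisymm hle (LSM.sInf_energy_le_relaxedEnergy u)⟩
  · rintro _ ⟨u, -, rfl⟩
    exact LSM.sInf_energy_le_relaxedEnergy u
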